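/- Let $n\ge 1$, $v\ge 0$ and $k_1,k_2\ge n$ be integers, and let $W=(w_{s,t})$, $Z=(z_{s,t})$ be $n\times n$ matrices of indeterminates. Let $\mathcal Q_{n,v}(2)$ be the space of polynomials $Q\in\mathbb C[W,Z]$ with $Q(AW\,{}^tB,AZ\,{}^tB)=\det(A)^v\det(B)^v\,Q(W,Z)$ for all $A,B\in \mathrm{GL}(n,\mathbb C)$. A polynomial $P(X,Y)$ in $X=(x_{s,u}),Y=(y_{s,u})\in M_{n,k}$, $k=k_1+k_2$, is pluriharmonic if $\sum_{u=1}^{k}\frac{\partial^2 P}{\partial x_{s,u}\partial y_{t,u}}=0$ for all $1\le s,t\le n$. Let $\mathcal H_{n,v}(k_1,k_2)$ be the space of $Q\in\mathcal Q_{n,v}(2)$ such that $Q(X_1{}^tY_1,X_2{}^tY_2)$ is pluriharmonic, where $X=(X_1,X_2)$, $Y=(Y_1,Y_2)$ and $X_i,Y_i\in M_{n,k_i}$. Define $Q_0,\dots,Q_n\in\mathbb C[W,Z]$ by $\det(W+\lambda Z)=\sum_{a=0}^n Q_a\lambda^a$. (1) Every $Q\in\mathcal Q_{n,v}(2)$ can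 be written in exactly one way as $Q=\sum_{\alpha}C(\alpha)\prod_{j=0}^nQ_j^{\alpha_j}$ with $C(\alpha)\in\mathbb C$, where $\alpha=(\alpha_0,\dots,\alpha_n)$ runs over the tuples in $\mathbb Z_{\ge 0}^{n+1}$ with $\sum_j\alpha_j=v$. (2) A polynomial $Q=\sum_{\alpha}C(\alpha)\prod_{j}Q_j^{\alpha_j}$ of this form lies in $\mathcal H_{n,v}(k_1,k_2)$ if and only if its coefficients satisfy, for every $\alpha\ne(0,\dots,0,v)$, with $0\le m<n$ the least index such that $\alpha_m>0$, the linear relation $$\begin{aligned}0={}&C(\alpha)\,\alpha_m(k_1+1-n+m)+C(\alpha-1_m+1_{m+1})\,(\alpha-1_m+1_{m+1})_{m+1}(k_2-m)+C(\alpha)\,\alpha_m(\alpha_m-1)\\&+\sum_{\substack{m<\ell\le\ell'\le n\\ \ell+\ell'-m-1\le n}}C(\tilde\alpha(m,\ell,\ell'))\,\tilde\alpha(m,\ell,\ell')_\ell\,(\tilde\alpha(m,\ell,\ell')_{\ell'}-\delta_{\ell,\ell'})(2-\delta_{\ell,\ell'})\\&-\sum_{\substack{m<\ell\le\ell'\le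 n\\ \ell+\ell'-m\le n}}C(\alpha(m,\ell,\ell'))\,\alpha(m,\ell,\ell')_\ell\,(\alpha(m,\ell,\ell')_{\ell'}-\delta_{\ell,\ell'})(2-\delta_{\ell,\ell'}).\end{aligned}$$ Here $1_j$ is the tuple with $1$ in position $j$ and $0$ elsewhere, $\alpha(m,\ell,\ell')=\alpha-1_m+1_\ell+1_{\ell'}-1_{\ell+\ell'-m}$, $\tilde\alpha(m,\ell,\ell')=\alpha-1_m+1_\ell+1_{\ell'}-1_{\ell+\ell'-m-1}$, and $C(\beta)=0$ if $\beta$ has a negative entry. (3) These relations determine every $C(\alpha)$ from $C(0,\dots,0,v)$: for each $c\in\mathbb C$ they have exactly one solution with $C(0,\dots,0,v)=c$. (4) $\mathcal H_{n,v}(k_1,k_2)$ is one-dimensional over $\mathbb C$. (5) For $Q\in\mathbb C[W,Z]$ let $D_Q$ be the operator that sends a pair $(F_1,F_2)$ of holomorphic functions on the Hermitian upper half-space $\mathbb H_n=\{Z\in M_n(\mathbb C)\mid \frac1{2i}(Z-Z^*)>0\}$ to the function $Q\left(\frac{\partial}{\partial Z_1},\frac{\partial}{\partial Z_2}\right)\bigl(F_1(Z_1)F_2(Z_2)\bigr)\big|_{Z_1=Z_2=Z}$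 on $\mathbb H_n$, where $\left(\frac{\partial}{\partial Z}\right)_{s,t}=\frac{\partial}{\partial z_{t,s}}$. Then the space of bilinear Rankin–Cohen type operators $\{D_Q\mid Q\in\mathcal H_{n,v}(k_1,k_2)\}$ is one-dimensional; that is, there is a nonzero such operator, unique up to scaling. -/

import Mathlib

open scoped Matrix ComplexOrder

attribute [local instance] Matrix.normedAddCommGroup Matrix.normedSpace

noncomputable section

namespace RankinCohen

/-! Polynomials in two `n × n` matrices of indeterminates `W = (w_{s,t})`, `Z = (z_{s,t})`. -/

/-- The polynomial ring `ℂ[W, Z]`; `Sum.inl (s, t)` indexes `w_{s,t}` and `Sum.inr (s, t)`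
indexes `z_{s,t}`. -/
abbrev PolyWZ (n : ℕ) : Type :=
  MvPolynomial ((Fin n × Fin n) ⊕ (Fin n × Fin n)) ℂ

/-- The generic matrix `W`. -/
def matW (n : ℕ) : Matrix (Fin n) (Fin n) (PolyWZ n) :=
  Matrix.of fun s t => MvPolynomial.X (Sum.inl (s, t))

/-- The generic matrix `Z`. -/
def matZ (n : ℕ) : Matrix (Fin n) (Fin n) (PolyWZ n) :=
  Matrix.of fun s t => MvPolynomial.X (Sum.inr (s, t))

/-- The substitution `Q ↦ Q(M, N)`, for square matrices `M`, `N` over a commutative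
`ℂ`-algebra. -/
def substWZ {n : ℕ} {R : Type} [CommRing R] [Algebra ℂ R] (M N : Matrix (Fin n) (Fin n) R) :
    PolyWZ n →ₐ[ℂ] R :=
  MvPolynomial.aeval (Sum.elim (fun p => M p.1 p.2) (fun p => N p.1 p.2))

/-- A complex matrix, regarded as a matrix of constant polynomials. -/
def constMat {n : ℕ} (A : Matrix (Fin n) (Fin n) ℂ) : Matrix (Fin n) (Fin n) (PolyWZ n) :=
  A.map (algebraMap ℂ (PolyWZ n))

/-- The space `𝒬_{n,v}(2)` of all polynomials `Q` in `ℂ[W, Z]` with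
`Q(A W ᵗB, A Z ᵗB) = det(A)^v det(B)^v Q(W, Z)` for all `A, B ∈ GL(n, ℂ)`. -/
def spaceQ (n v : ℕ) : Submodule ℂ (PolyWZ n) where
  carrier := {Q | ∀ A B : Matrix.GeneralLinearGroup (Fin n) ℂ,
    substWZ (constMat A.val * matW n * (constMat B.val)ᵀ)
        (constMat A.val * matZ n * (constMat B.val)ᵀ) Q =
      (A.val.det ^ v * B.val.det ^ v) • Q}
  add_mem' := by
    intro P Q hP hQ A B
    rw [map_add, hP A B, hQ A B, smul_add]
  zero_mem' := by
    intro A B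
    rw [map_zero, smul_zero]
  smul_mem' := by
    intro c Q hQ A B
    rw [map_smul, hQ A B, smul_comm]

/-! Polynomials in `X, Y ∈ M_{n,k}`, where `k = k₁ + k₂` and the columns are grouped in a first
block of `k₁` and a second block of `k₂` columns. -/

/-- The polynomial ring `ℂ[X, Y]`, for `X` and `Y` with `n` rows and columns indexed by `κ`;
`Sum.inl (s, u)` indexes `x_{s,u}` and `Sum.inr (s, u)` indexes `y_{s,u}`. -/
abbrev PolyXY (n : ℕ) (κ : Type) : Type :=
  MvPolynomial ((Fin n × κ) ⊕ (Fin n × κ)) ℂ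

/-- The operator `Δ_{s,t} = ∑_u ∂² / ∂x_{s,u} ∂y_{t,u}`. -/
def laplacian {n : ℕ} {κ : Type} [Fintype κ] (s t : Fin n) (P : PolyXY n κ) : PolyXY n κ :=
  ∑ u : κ, MvPolynomial.pderiv (Sum.inl (s, u)) (MvPolynomial.pderiv (Sum.inr (t, u)) P)

/-- `P(X, Y)` is pluriharmonic if it is annihilated by every `Δ_{s,t}`. -/
def IsPluriharmonic {n : ℕ} {κ : Type} [Fintype κ] (P : PolyXY n κ) : Prop :=
  ∀ s t : Fin n, laplacian s t P = 0

/-- The submatrix of the generic `X` with the columns `f j`. -/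
def matX (n : ℕ) {κ ι : Type} (f : ι → κ) : Matrix (Fin n) ι (PolyXY n κ) :=
  Matrix.of fun s j => MvPolynomial.X (Sum.inl (s, f j))

/-- The submatrix of the generic `Y` with the columns `f j`. -/
def matY (n : ℕ) {κ ι : Type} (f : ι → κ) : Matrix (Fin n) ι (PolyXY n κ) :=
  Matrix.of fun s j => MvPolynomial.X (Sum.inr (s, f j))

/-- The substitution `Q ↦ Q(X₁ ᵗY₁, X₂ ᵗY₂)`, where `X = (X₁, X₂)` and `Y = (Y₁, Y₂)` with
`X_i, Y_i ∈ M_{n,k_i}`. -/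
def pullback (n k₁ k₂ : ℕ) : PolyWZ n →ₐ[ℂ] PolyXY n (Fin k₁ ⊕ Fin k₂) :=
  substWZ (matX n (Sum.inl : Fin k₁ → Fin k₁ ⊕ Fin k₂) * (matY n Sum.inl)ᵀ)
    (matX n (Sum.inr : Fin k₂ → Fin k₁ ⊕ Fin k₂) * (matY n Sum.inr)ᵀ)

/-- The space `ℋ_{n,v}(k₁, k₂)` of all `Q ∈ 𝒬_{n,v}(2)` for which `Q(X₁ ᵗY₁, X₂ ᵗY₂)` is
pluriharmonic. -/
def spaceH (n v k₁ k₂ : ℕ) : Submodule ℂ (PolyWZ n) where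
  carrier := {Q | Q ∈ spaceQ n v ∧ IsPluriharmonic (pullback n k₁ k₂ Q)}
  add_mem' := by
    rintro P Q ⟨hP, hP'⟩ ⟨hQ, hQ'⟩
    refine ⟨add_mem hP hQ, fun s t => ?_⟩
    have h₁ := hP' s t
    have h₂ := hQ' s t
    simp only [laplacian] at h₁ h₂ ⊢
    simp only [map_add, Finset.sum_add_distrib, h₁, h₂, add_zero]
  zero_mem' := ⟨zero_mem _, fun s t => by simp [laplacian]⟩
  smul_mem' := by
    rintro c Q ⟨hQ, hQ'⟩
    refine ⟨Submodule.smul_mem _ c hQ, fun s t => ?_⟩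
    have h := hQ' s t
    simp only [laplacian] at h ⊢
    simp only [map_smul, Derivation.map_smul, ← Finset.smul_sum, h, smul_zero]

/-! The polynomials `Q_0, …, Q_n` and the coefficients `C(α)`. -/

/-- `Q_a`, the coefficient of `λ^a` in `det(W + λ Z)`. -/
def polyQ (n a : ℕ) : PolyWZ n :=
  (((matW n).map Polynomial.C + (Polynomial.X : Polynomial (PolyWZ n)) •
    (matZ n).map Polynomial.C).det).coeff a

/-- The tuples `α = (α_0, …, α_n)` of nonnegative integers with `α_0 + ⋯ + α_n = v`. -/
abbrev Index (n v : ℕ) : Type :=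
  {α : Fin (n + 1) → ℕ // α ∈ Finset.piAntidiag Finset.univ v}

/-- The tuple `(0, …, 0, v)`. -/
def lastIndex (n v : ℕ) : Index n v :=
  ⟨Pi.single (Fin.last n) v, by simp [Finset.mem_piAntidiag]⟩

/-- The polynomial `∑_α C(α) ∏_j Q_j^{α_j}`. -/
def ofCoeffs {n v : ℕ} (C : Index n v → ℂ) : PolyWZ n :=
  ∑ α : Index n v, C α • ∏ j : Fin (n + 1), polyQ n j ^ α.1 j

/-- The coefficient `C(β)` for an integer tuple `β`: it is zero unless `β` is a tuple of
nonnegative integers with sum `v` (the sum below has at most one nonzero term). -/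
def coeffExt {n v : ℕ} (C : Index n v → ℂ) (β : Fin (n + 1) → ℤ) : ℂ :=
  ∑ α : Index n v, if ∀ j, (α.1 j : ℤ) = β j then C α else 0

/-- The tuple `1_j`, with entry `1` in position `j` and `0` elsewhere. -/
def unitTuple (n j : ℕ) : Fin (n + 1) → ℤ := fun i => if (i : ℕ) = j then 1 else 0

/-- `α(m,ℓ,ℓ') = α - 1_m + 1_ℓ + 1_{ℓ'} - 1_{ℓ+ℓ'-m}`; used for `m < ℓ ≤ ℓ'` only. -/
def shift {n : ℕ} (α : Fin (n + 1) → ℤ) (m l l' : ℕ) : Fin (n + 1) → ℤ :=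
  α - unitTuple n m + unitTuple n l + unitTuple n l' - unitTuple n (l + l' - m)

/-- `α̃(m,ℓ,ℓ') = α - 1_m + 1_ℓ + 1_{ℓ'} - 1_{ℓ+ℓ'-m-1}`; used for `m < ℓ ≤ ℓ'` only. -/
def shiftTilde {n : ℕ} (α : Fin (n + 1) → ℤ) (m l l' : ℕ) : Fin (n + 1) → ℤ :=
  α - unitTuple n m + unitTuple n l + unitTuple n l' - unitTuple n (l + l' - m - 1)

/-- The integer `β_ℓ (β_{ℓ'} - δ_{ℓ,ℓ'}) (2 - δ_{ℓ,ℓ'})`. -/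
def pairFactor {n : ℕ} (β : Fin (n + 1) → ℤ) (l l' : Fin (n + 1)) : ℤ :=
  β l * (β l' - if l = l' then 1 else 0) * (2 - if l = l' then 1 else 0)

/-- The right-hand side of the linear relation attached to a tuple `α` and a position `m < n`. -/
def relationExpr {n v : ℕ} (k₁ k₂ : ℕ) (C : Index n v → ℂ) (α : Fin (n + 1) → ℤ)
    (m : Fin n) : ℂ :=
  coeffExt C α * ((α m.castSucc * ((k₁ : ℤ) + 1 - n + (m : ℕ)) : ℤ) : ℂ)
    + coeffExt C (α - unitTuple n m + unitTuple n ((m : ℕ) + 1)) *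
        (((α - unitTuple n m + unitTuple n ((m : ℕ) + 1)) m.succ * ((k₂ : ℤ) - (m : ℕ)) : ℤ) : ℂ)
    + coeffExt C α * ((α m.castSucc * (α m.castSucc - 1) : ℤ) : ℂ)
    + ∑ l : Fin (n + 1), ∑ l' : Fin (n + 1),
        (if (m : ℕ) < l ∧ l ≤ l' ∧ (l : ℕ) + l' - m - 1 ≤ n then
          coeffExt C (shiftTilde α m l l') * ((pairFactor (shiftTilde α m l l') l l' : ℤ) : ℂ)
        else 0)
    - ∑ l : Fin (n + 1), ∑ l' : Fin (n + 1),
        (if (m : ℕ) < l ∧ l ≤ l' ∧ (l : ℕ) + l' - m ≤ n then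
          coeffExt C (shift α m l l') * ((pairFactor (shift α m l l') l l' : ℤ) : ℂ)
        else 0)

/-- The system of linear relations on the coefficients: for every `α ≠ (0, …, 0, v)`, with `m`
the least index such that `α_m > 0`, the expression above vanishes. -/
def SatisfiesRelations {n v : ℕ} (k₁ k₂ : ℕ) (C : Index n v → ℂ) : Prop :=
  ∀ α : Index n v, α ≠ lastIndex n v → ∀ m : Fin n,
    0 < α.1 m.castSucc → (∀ j : Fin (n + 1), j < m.castSucc → α.1 j = 0) →
      relationExpr k₁ k₂ C (fun j => (α.1 j : ℤ)) m = 0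

/-! The bilinear differential operators. -/

/-- The Hermitian upper half-space `{Z ∈ M_n(ℂ) | (1/2i)(Z - Z^*) > 0}`. -/
def upperHalf (n : ℕ) : Set (Matrix (Fin n) (Fin n) ℂ) :=
  {Z | ((1 / (2 * Complex.I)) • (Z - Zᴴ)).PosDef}

/-- Functions that are holomorphic on the Hermitian upper half-space; what follows uses their
values there only. -/
abbrev Hol (n : ℕ) : Type :=
  {F : Matrix (Fin n) (Fin n) ℂ → ℂ // DifferentiableOn ℂ F (upperHalf n)}

/-- The `(s,t)` entry of the matrix `∂/∂Z`, which is the partial derivative `∂/∂z_{t,s}`. -/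
def entryDeriv {n : ℕ} (p : Fin n × Fin n) (F : Matrix (Fin n) (Fin n) ℂ → ℂ) :
    Matrix (Fin n) (Fin n) ℂ → ℂ :=
  fun Z => lineDeriv ℂ F Z (Matrix.single p.2 p.1 1)

/-- The monomial `∏ (∂/∂Z)_{s,t}^{d(s,t)}`, as an iterated partial derivative (on holomorphic
functions the partial derivatives commute, so their order does not matter). -/
def monomialDeriv {n : ℕ} (d : Fin n × Fin n →₀ ℕ) (F : Matrix (Fin n) (Fin n) ℂ → ℂ) :
    Matrix (Fin n) (Fin n) ℂ → ℂ :=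
  (Finsupp.toMultiset d).toList.foldr entryDeriv F

/-- The bilinear differential operator attached to a polynomial `Q(W, Z)`:
`(F₁, F₂) ↦ Q(∂/∂Z₁, ∂/∂Z₂) (F₁(Z₁) F₂(Z₂))`, restricted to `Z₁ = Z₂ = Z`. It is the linear
extension of its values at the monomials `W^l Z^m`. -/
def bilinearOp (n : ℕ) : PolyWZ n →ₗ[ℂ] (Hol n → Hol n → upperHalf n → ℂ) :=
  (MvPolynomial.basisMonomials ((Fin n × Fin n) ⊕ (Fin n × Fin n)) ℂ).constr ℂ
    fun d F₁ F₂ Z =>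
      monomialDeriv (Finsupp.sumFinsuppEquivProdFinsupp d).1 F₁.1 Z.1 *
        monomialDeriv (Finsupp.sumFinsuppEquivProdFinsupp d).2 F₂.1 Z.1

end RankinCohen

end

/-! Write `M = W + λZ`, and let `A_c` be the coefficient of `λ^c` in `adj M`. Everything rests on
restricting invariant polynomials to one explicit family of pencils and on an adjointness argument
for existence.

Normal form. A companion-type pencil (`canonW`, `canonZ`) has determinant `∑ q_a λ^a` with arbitrary
`q_a`, and a generic pair `(W, Z)` is `GL × GL`-equivalent to such a pencil (`exists_canon_eq`). An
invariant `Q` is therefore determined by its restriction to this family, which is a homogeneous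
polynomial of degree `v` in the `q_a`. This gives existence and uniqueness of the expansion in the
`Q_a` (`existsUnique_ofCoeffs`).

Necessity of the relations. By the chain rule the Laplacian `Δ_{s,t}` becomes a second-order
operator `radialPart` on `ℂ[W, Z]`. The derivatives of the `Q_a` are entries of the `A_c`, and the
products `A_a W A_b`, `A_a Z A_b` are again combinations of the `A_c`. Hence the radial part of
`f(Q_0, …, Q_n)` is `∑_c (coordOp c f)(Q) · (A_c)_{t,s}` (`radialPart_substQ`). On the normal form
the first columns of `A_0, …, A_{n-1}` are the standard basis vectors, so each `coordOp c f` must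
vanish for a pluriharmonic element. The stated relation is its coefficient at `α - 1_m` with `c = m`
(`coeff_coordOp`).

Uniqueness. The relation for `α` expresses a nonzero multiple of `C(α)` through coefficients at
lexicographically smaller tuples (`eq_zero_of_satisfiesRelations`), so a solution is determined by
`C(0, …, 0, v)`.

Existence. For the Fischer product, `Δ_{s,t}` is adjoint to multiplication by the pullback of `(W +
Z)_{s,t}`. If `P` is the pullback of `Q`, then `∑ ‖Δ_{s,t} P‖²` pairs `P` with the pullback of an
invariant that vanishes at `W = 1`, `Z = -1`. A nonzero `Q` orthogonal to all such invariants is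
thus pluriharmonic (`exists_mem_spaceH`). With uniqueness, this yields the dimension and also the
sufficiency of the relations. The operators `D_Q` inherit the result because their values on
exponentials recover `Q` (`bilinearOp_injective`). -/

noncomputable section

namespace RankinCohen

/-! Matrix pencils `W + λ Z` over a commutative ring. -/

section Pencil

open Polynomial

variable {ι : Type*} {R : Type*} [CommRing R]

/-- The pencil `W + λ Z`. -/
def pencil (W Z : Matrix ι ι R) : Matrix ι ι R[X] :=
  W.map C + (X : R[X]) • Z.map C

lemma pencil_map {S : Type*} [CommRing S] (f : R →+* S) (W Z : Matrix ι ι R) :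
    pencil (W.map f) (Z.map f) = (pencil W Z).map (Polynomial.mapRingHom f) := by
  ext i j
  simp [pencil]

variable [Fintype ι] [DecidableEq ι]

/-- The coefficient of `λ^a` in `det (W + λ Z)`. -/
def detCoeff (W Z : Matrix ι ι R) (a : ℕ) : R := (pencil W Z).det.coeff a

/-- The coefficient of `λ^a` in the adjugate of `W + λ Z`. -/
def adjCoeff (W Z : Matrix ι ι R) (a : ℕ) : Matrix ι ι R :=
  Matrix.of fun i j => ((pencil W Z).adjugate i j).coeff a

lemma polyQ_eq_detCoeff (n a : ℕ) : polyQ n a = detCoeff (matW n) (matZ n) a := rfl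

lemma detCoeff_map {S : Type*} [CommRing S] (f : R →+* S) (W Z : Matrix ι ι R) (a : ℕ) :
    detCoeff (W.map f) (Z.map f) a = f (detCoeff W Z a) := by
  have h : ((pencil W Z).map (Polynomial.mapRingHom f)).det =
      Polynomial.mapRingHom f (pencil W Z).det := (RingHom.map_det _ _).symm
  rw [detCoeff, detCoeff, pencil_map, h, Polynomial.coe_mapRingHom, Polynomial.coeff_map]

lemma adjCoeff_map {S : Type*} [CommRing S] (f : R →+* S) (W Z : Matrix ι ι R) (a : ℕ) :
    adjCoeff (W.map f) (Z.map f) a = (adjCoeff W Z a).map f := by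
  have h : ((pencil W Z).map (Polynomial.mapRingHom f)).adjugate =
      (pencil W Z).adjugate.map (Polynomial.mapRingHom f) := (RingHom.map_adjugate _ _).symm
  ext i j
  rw [adjCoeff, pencil_map, h]
  simp [adjCoeff, Polynomial.coeff_map]

lemma pencil_mul_mul (A B W Z : Matrix ι ι R) :
    pencil (A * W * B) (A * Z * B) = A.map C * pencil W Z * B.map C := by
  simp only [pencil, Matrix.map_mul, mul_add, add_mul, Matrix.mul_smul, Matrix.smul_mul]

lemma detCoeff_mul_mul (A B W Z : Matrix ι ι R) (a : ℕ) :
    detCoeff (A * W * B) (A * Z * B) a = A.det * B.det * detCoeff W Z a := by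
  have h : ∀ M : Matrix ι ι R, (M.map C).det = C M.det := fun M => (RingHom.map_det C M).symm
  rw [detCoeff, pencil_mul_mul, Matrix.det_mul, Matrix.det_mul, h, h, mul_right_comm, ← C_mul,
    coeff_C_mul, detCoeff]

lemma detCoeff_zero (W Z : Matrix ι ι R) : detCoeff W Z 0 = W.det := by
  have h : (evalRingHom 0).mapMatrix (pencil W Z) = W := by
    ext i j
    simp [pencil]
  rw [detCoeff, coeff_zero_eq_eval_zero, ← coe_evalRingHom, RingHom.map_det, h]

lemma detCoeff_eq_zero_of_lt (W Z : Matrix ι ι R) {a : ℕ} (ha : Fintype.card ι < a) :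
    detCoeff W Z a = 0 := by
  rw [detCoeff, pencil, add_comm]
  exact coeff_eq_zero_of_natDegree_lt ((natDegree_det_X_add_C_le Z W).trans_lt ha)

lemma coeff_adjugate_mul_map_C (W Z N : Matrix ι ι R) (a : ℕ) (i j : ι) :
    (((pencil W Z).adjugate * N.map C) i j).coeff a = (adjCoeff W Z a * N) i j := by
  simp [Matrix.mul_apply, adjCoeff, coeff_mul_C]

lemma coeff_map_C_mul_adjugate (W Z N : Matrix ι ι R) (a : ℕ) (i j : ι) :
    ((N.map C * (pencil W Z).adjugate) i j).coeff a = (N * adjCoeff W Z a) i j := by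
  simp [Matrix.mul_apply, adjCoeff, coeff_C_mul]

/-- Comparing powers of `λ` in `adj(M) M = det(M) 1` and `M adj(M) = det(M) 1` gives this identity
and the next two, which are the source of the quadratic relations below. -/
lemma adjCoeff_zero_mul (W Z : Matrix ι ι R) :
    adjCoeff W Z 0 * W = detCoeff W Z 0 • (1 : Matrix ι ι R) := by
  ext i j
  have h := congrArg (fun M => (M i j).coeff 0) (Matrix.adjugate_mul (pencil W Z))
  conv at h => lhs; rw [show pencil W Z = W.map C + (X : R[X]) • Z.map C from rfl]
  simp only [mul_add, Matrix.mul_smul] at h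
  rw [← pencil, Matrix.add_apply, coeff_add, coeff_adjugate_mul_map_C, Matrix.smul_apply,
    smul_eq_mul, coeff_X_mul_zero, add_zero] at h
  rw [h]
  by_cases hij : i = j <;> simp [hij, detCoeff]

lemma adjCoeff_succ_mul (W Z : Matrix ι ι R) (a : ℕ) :
    adjCoeff W Z (a + 1) * W + adjCoeff W Z a * Z =
      detCoeff W Z (a + 1) • (1 : Matrix ι ι R) := by
  ext i j
  have h := congrArg (fun M => (M i j).coeff (a + 1)) (Matrix.adjugate_mul (pencil W Z))
  conv at h => lhs; rw [show pencil W Z = W.map C + (X : R[X]) • Z.map C from rfl]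
  simp only [mul_add, Matrix.mul_smul] at h
  rw [← pencil, Matrix.add_apply, coeff_add, coeff_adjugate_mul_map_C, Matrix.smul_apply,
    smul_eq_mul, coeff_X_mul, coeff_adjugate_mul_map_C] at h
  rw [Matrix.add_apply, h]
  by_cases hij : i = j <;> simp [hij, detCoeff]

lemma mul_adjCoeff_succ (W Z : Matrix ι ι R) (a : ℕ) :
    W * adjCoeff W Z (a + 1) + Z * adjCoeff W Z a =
      detCoeff W Z (a + 1) • (1 : Matrix ι ι R) := by
  ext i j
  have h := congrArg (fun M => (M i j).coeff (a + 1)) (Matrix.mul_adjugate (pencil W Z))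
  conv at h => lhs; rw [show pencil W Z = W.map C + (X : R[X]) • Z.map C from rfl]
  simp only [add_mul, Matrix.smul_mul] at h
  rw [← pencil, Matrix.add_apply, coeff_add, coeff_map_C_mul_adjugate, Matrix.smul_apply,
    smul_eq_mul, coeff_X_mul, coeff_map_C_mul_adjugate] at h
  rw [Matrix.add_apply, h]
  by_cases hij : i = j <;> simp [hij, detCoeff]

/-- The sign with which `Q_{a+b-c} A_c` occurs in `A_a W A_b`. -/
def pencilSign (a b c : ℕ) : ℤ :=
  (if max a b ≤ c then 1 else 0) - (if c < min a b then 1 else 0)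

/-- The recursion that trades a step in `a` for a step in `b`; the two unit terms stand for `Q_{a+1}
A_b` and `Q_{b+1} A_a`. -/
lemma pencilSign_succ_left (a b c : ℕ) :
    pencilSign (a + 1) b c =
      (if c = b then 1 else 0) - (if c = a then 1 else 0) + pencilSign a (b + 1) c := by
  unfold pencilSign
  split_ifs <;> omega

/-- The product `A_a Z A_b` occurs in both adjugate identities, once from the left and once from the
right; eliminating it leaves this recursion. -/
lemma adjCoeff_mul_mul_adjCoeff_succ (W Z : Matrix ι ι R) (a b : ℕ) :
    adjCoeff W Z (a + 1) * W * adjCoeff W Z b =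
      detCoeff W Z (a + 1) • adjCoeff W Z b - detCoeff W Z (b + 1) • adjCoeff W Z a +
        adjCoeff W Z a * W * adjCoeff W Z (b + 1) := by
  have h₁ := congrArg (· * adjCoeff W Z b) (adjCoeff_succ_mul W Z a)
  have h₂ := congrArg (adjCoeff W Z a * ·) (mul_adjCoeff_succ W Z b)
  simp only [add_mul, mul_add, Matrix.smul_mul, Matrix.mul_smul, one_mul, mul_one,
    ← mul_assoc] at h₁ h₂
  rw [← h₁, ← h₂]
  abel

/-- `A_a W A_b` in terms of the `A_c` and `Q_e`. -/
lemma adjCoeff_mul_W_mul_adjCoeff (W Z : Matrix ι ι R) (a b : ℕ) :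
    adjCoeff W Z a * W * adjCoeff W Z b =
      ∑ c ∈ Finset.range (a + b + 1),
        pencilSign a b c • detCoeff W Z (a + b - c) • adjCoeff W Z c := by
  induction a generalizing b with
  | zero =>
    -- `A_0 W = Q_0`, and for `a = 0` the sign is nonzero within the range `c ≤ b` only at `c = b`.
    rw [adjCoeff_zero_mul, Finset.sum_eq_single b]
    · simp [pencilSign]
    · intro c hc hcb
      rw [Finset.mem_range] at hc
      have : ¬ b ≤ c := by omega
      simp [pencilSign, this]
    · intro h
      simp at h
  | succ a ih =>
    rw [adjCoeff_mul_mul_adjCoeff_succ, ih, show a + 1 + b + 1 = a + (b + 1) + 1 by ring,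
      show a + 1 + b = a + (b + 1) by ring]
    simp_rw [pencilSign_succ_left, add_smul, sub_smul, ite_smul, one_smul, zero_smul]
    rw [Finset.sum_add_distrib, Finset.sum_sub_distrib, Finset.sum_ite_eq', Finset.sum_ite_eq',
      if_pos (Finset.mem_range.2 (by omega)), if_pos (Finset.mem_range.2 (by omega))]
    congr 4 <;> omega

/-- `A_a Z A_b` in terms of the `A_c` and `Q_e`. -/
lemma adjCoeff_mul_Z_mul_adjCoeff (W Z : Matrix ι ι R) (a b : ℕ) :
    adjCoeff W Z a * Z * adjCoeff W Z b =
      -∑ c ∈ Finset.range (a + b + 2),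
        pencilSign (a + 1) (b + 1) c • detCoeff W Z (a + b + 1 - c) • adjCoeff W Z c := by
  -- `A_a Z A_b = Q_{b+1} A_a - A_a W A_{b+1}` reduces this to the previous formula; the extra term
  -- is absorbed by shifting both arguments of the sign.
  have h := congrArg (adjCoeff W Z a * ·) (mul_adjCoeff_succ W Z b)
  simp only [mul_add, Matrix.mul_smul, mul_one, ← mul_assoc] at h
  have h' : ∀ c, pencilSign (a + 1) (b + 1) c =
      pencilSign a (b + 1) c - (if c = a then 1 else 0) := by
    intro c
    unfold pencilSign
    split_ifs <;> omega
  rw [adjCoeff_mul_W_mul_adjCoeff] at h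
  rw [← add_right_inj, h]
  simp_rw [h', sub_smul, ite_smul, one_smul, zero_smul]
  rw [Finset.sum_sub_distrib, Finset.sum_ite_eq', if_pos (by simp; omega),
    show a + (b + 1) + 1 = a + b + 2 by ring, show a + b + 1 - a = b + 1 by omega]
  simp only [← add_assoc]
  abel

end Pencil

/-! Derivatives of determinants and adjugates. -/

section DerivationDet

variable {ι : Type*} [Fintype ι] {𝕜 R : Type*} [CommRing 𝕜] [CommRing R] [Algebra 𝕜 R]

lemma derivation_matrix_mul (D : Derivation 𝕜 R R) (M N : Matrix ι ι R) :
    (M * N).map D = M.map D * N + M * N.map D := by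
  ext i j
  simp only [Matrix.map_apply, Matrix.mul_apply, Matrix.add_apply, map_sum, Derivation.leibniz,
    smul_eq_mul, Finset.sum_add_distrib]
  rw [add_comm]
  congr 1
  exact Finset.sum_congr rfl fun _ _ => mul_comm _ _

variable [DecidableEq ι]

lemma derivation_finset_prod {κ : Type*} [DecidableEq κ] (D : Derivation 𝕜 R R) (s : Finset κ)
    (f : κ → R) :
    D (∏ i ∈ s, f i) = ∑ i ∈ s, (∏ j ∈ s.erase i, f j) * D (f i) := by
  induction s using Finset.induction_on with
  | empty => simp
  | insert a s ha ih =>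
    rw [Finset.prod_insert ha, Derivation.leibniz, ih, Finset.sum_insert ha,
      Finset.erase_insert ha, smul_eq_mul, smul_eq_mul, add_comm, Finset.mul_sum]
    congr 1
    refine Finset.sum_congr rfl fun i hi => ?_
    have hia : a ≠ i := fun h => ha (h ▸ hi)
    rw [Finset.erase_insert_of_ne hia, Finset.prod_insert (by simp [ha]), mul_assoc]

/-- Jacobi's formula: by Cramer's rule the `i`-th diagonal entry is the determinant with column `i`
differentiated, and these add up to the Leibniz expansion. -/
lemma derivation_det (D : Derivation 𝕜 R R) (M : Matrix ι ι R) :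
    D M.det = (M.adjugate * M.map D).trace := by
  have h : ∀ i, (M.adjugate * M.map D) i i = (M.updateCol i fun j => D (M j i)).det := by
    intro i
    rw [← Matrix.cramer_apply, Matrix.cramer_eq_adjugate_mulVec]
    rfl
  simp only [Matrix.trace, Matrix.diag_apply, h, Matrix.det_apply, map_sum]
  rw [Finset.sum_comm]
  refine Finset.sum_congr rfl fun σ _ => ?_
  rw [Units.smul_def, map_zsmul, derivation_finset_prod, Finset.smul_sum]
  refine Finset.sum_congr rfl fun i _ => ?_
  rw [Units.smul_def, ← Finset.mul_prod_erase _ _ (Finset.mem_univ i), Matrix.updateCol_self,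
    mul_comm]
  congr 2
  refine Finset.prod_congr rfl fun j hj => ?_
  rw [Matrix.updateCol_ne (Finset.ne_of_mem_erase hj)]

/-- Differentiate `adj(M) M = det(M) 1` and multiply on the right by `adj(M)`; no inverse of `M` is
needed. -/
lemma derivation_adjugate (D : Derivation 𝕜 R R) (M : Matrix ι ι R) :
    M.det • M.adjugate.map D =
      D M.det • M.adjugate - M.adjugate * M.map D * M.adjugate := by
  have h := congrArg (fun N => N.map D * M.adjugate) (Matrix.adjugate_mul M)
  simp only [derivation_matrix_mul, add_mul] at h
  have h₁ : (M.det • (1 : Matrix ι ι R)).map D = D M.det • (1 : Matrix ι ι R) := by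
    ext i j
    by_cases hij : i = j <;> simp [hij]
  rw [h₁, mul_assoc, Matrix.mul_adjugate, Matrix.smul_mul, one_mul, Matrix.mul_smul,
    mul_one] at h
  rw [← h]
  abel

/-- The coefficientwise extension of a derivation to polynomials. -/
def coeffDerivation (D : Derivation 𝕜 R R) : Derivation 𝕜 (Polynomial R) (Polynomial R) :=
  ((PolynomialModule.equivPolynomialSelf (R := R)).toLinearMap).compDer D.mapCoeffs

lemma coeff_coeffDerivation (D : Derivation 𝕜 R R) (p : Polynomial R) (a : ℕ) :
    (coeffDerivation D p).coeff a = D (p.coeff a) := rfl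

@[simp]
lemma coeffDerivation_C (D : Derivation 𝕜 R R) (r : R) :
    coeffDerivation D (Polynomial.C r) = Polynomial.C (D r) := by
  ext a
  rw [coeff_coeffDerivation, Polynomial.coeff_C, Polynomial.coeff_C]
  split_ifs <;> simp

@[simp]
lemma coeffDerivation_X (D : Derivation 𝕜 R R) :
    coeffDerivation D (Polynomial.X : Polynomial R) = 0 := by
  ext a
  rw [coeff_coeffDerivation, Polynomial.coeff_X]
  split_ifs <;> simp

end DerivationDet

/-! Partial derivatives of the `Q_a`. -/

section PartialDerivatives

open Polynomial

variable {n : ℕ}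

/-- The derivation `∂/∂w_{s,t}`. -/
abbrev derivW (s t : Fin n) : Derivation ℂ (PolyWZ n) (PolyWZ n) :=
  MvPolynomial.pderiv (Sum.inl (s, t))

/-- The derivation `∂/∂z_{s,t}`. -/
abbrev derivZ (s t : Fin n) : Derivation ℂ (PolyWZ n) (PolyWZ n) :=
  MvPolynomial.pderiv (Sum.inr (s, t))

/-- The generic pencil. -/
abbrev genPencil (n : ℕ) : Matrix (Fin n) (Fin n) (PolyWZ n)[X] := pencil (matW n) (matZ n)

lemma genPencil_map_derivW (s t : Fin n) :
    (genPencil n).map (coeffDerivation (derivW s t)) = Matrix.single s t 1 := by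
  ext1 i j
  simp only [pencil, Matrix.map_apply, Matrix.add_apply, Matrix.smul_apply, smul_eq_mul, map_add,
    Derivation.leibniz, coeffDerivation_C, coeffDerivation_X, matW, matZ, Matrix.of_apply,
    MvPolynomial.pderiv_X, Matrix.single_apply]
  by_cases h : s = i ∧ t = j
  · obtain ⟨rfl, rfl⟩ := h
    simp
  · have h' : (i, j) ≠ (s, t) := fun e => h ⟨(Prod.mk.inj e).1.symm, (Prod.mk.inj e).2.symm⟩
    simp [h, h']

lemma genPencil_map_derivZ (s t : Fin n) :
    (genPencil n).map (coeffDerivation (derivZ s t)) = Matrix.single s t X := by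
  ext1 i j
  simp only [pencil, Matrix.map_apply, Matrix.add_apply, Matrix.smul_apply, smul_eq_mul, map_add,
    Derivation.leibniz, coeffDerivation_C, coeffDerivation_X, matW, matZ, Matrix.of_apply,
    MvPolynomial.pderiv_X, Matrix.single_apply]
  by_cases h : s = i ∧ t = j
  · obtain ⟨rfl, rfl⟩ := h
    simp
  · have h' : (i, j) ≠ (s, t) := fun e => h ⟨(Prod.mk.inj e).1.symm, (Prod.mk.inj e).2.symm⟩
    simp [h, h']

lemma genPencil_map_derivative :
    (genPencil n).map (Polynomial.derivative' (R := PolyWZ n)) = (matZ n).map C := by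
  ext1 i j
  simp [pencil]

lemma genPencil_det_ne_zero : (genPencil n).det ≠ 0 := by
  intro h
  have h₀ : detCoeff (matW n) (matZ n) 0 = 0 := by rw [detCoeff, h, coeff_zero]
  rw [detCoeff_zero] at h₀
  have h₁ := congrArg (MvPolynomial.aeval (R := ℂ)
    (Sum.elim (fun p : Fin n × Fin n => (1 : Matrix (Fin n) (Fin n) ℂ) p.1 p.2) fun _ => 0)) h₀
  rw [AlgHom.map_det, map_zero] at h₁
  have h₂ : (MvPolynomial.aeval (R := ℂ)
    (Sum.elim (fun p : Fin n × Fin n => (1 : Matrix (Fin n) (Fin n) ℂ) p.1 p.2)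
      fun _ => 0)).mapMatrix (matW n) = 1 := by
    ext i j
    simp [matW]
  rw [h₂, Matrix.det_one] at h₁
  exact one_ne_zero h₁

lemma derivW_det (s t : Fin n) :
    coeffDerivation (derivW s t) (genPencil n).det = (genPencil n).adjugate t s := by
  rw [derivation_det, genPencil_map_derivW, Matrix.trace_mul_single]
  simp

lemma derivZ_det (s t : Fin n) :
    coeffDerivation (derivZ s t) (genPencil n).det = X * (genPencil n).adjugate t s := by
  rw [derivation_det, genPencil_map_derivZ, Matrix.trace_mul_single]
  simp [mul_comm]

lemma mul_single_mul_apply {ι S : Type*} [Fintype ι] [DecidableEq ι] [CommRing S]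
    (A B : Matrix ι ι S) (i j p q : ι) (c : S) :
    (A * Matrix.single i j c * B) p q = c * A p i * B j q := by
  rw [Matrix.mul_assoc, Matrix.mul_apply, Finset.sum_eq_single i]
  · rw [Matrix.single_mul_apply_same]
    ring
  · intro b _ hb
    rw [Matrix.single_mul_apply_of_ne _ _ _ _ _ hb, mul_zero]
  · simp

/-- This is `derivation_adjugate` in a matrix-unit direction; the right-hand side is a 2 × 2 minor
of the adjugate. -/
lemma det_mul_derivW_adjugate (i t j s : Fin n) :
    (genPencil n).det * coeffDerivation (derivW i t) ((genPencil n).adjugate j s) =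
      (genPencil n).adjugate t i * (genPencil n).adjugate j s -
        (genPencil n).adjugate j i * (genPencil n).adjugate t s := by
  have h := congrFun (congrFun (derivation_adjugate (coeffDerivation (derivW i t))
    (genPencil n)) j) s
  rw [derivW_det, genPencil_map_derivW, Matrix.sub_apply, mul_single_mul_apply] at h
  simpa using h

lemma det_mul_derivZ_adjugate (i t j s : Fin n) :
    (genPencil n).det * coeffDerivation (derivZ i t) ((genPencil n).adjugate j s) =
      X * ((genPencil n).adjugate t i * (genPencil n).adjugate j s -
        (genPencil n).adjugate j i * (genPencil n).adjugate t s) := by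
  have h := congrFun (congrFun (derivation_adjugate (coeffDerivation (derivZ i t))
    (genPencil n)) j) s
  rw [derivZ_det, genPencil_map_derivZ, Matrix.sub_apply, mul_single_mul_apply] at h
  simp only [Matrix.smul_apply, Matrix.map_apply, smul_eq_mul] at h
  rw [h]
  ring

/-- Here the derivation is `d/dλ`, under which the pencil has derivative `Z`. -/
lemma adjugate_Z_adjugate :
    (genPencil n).adjugate * (matZ n).map C * (genPencil n).adjugate =
      derivative (genPencil n).det • (genPencil n).adjugate -
        (genPencil n).det • (genPencil n).adjugate.map derivative := by
  have h := derivation_adjugate (Polynomial.derivative' (R := PolyWZ n)) (genPencil n)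
  rw [genPencil_map_derivative] at h
  have h' : (genPencil n).adjugate.map (Polynomial.derivative' (R := PolyWZ n)) =
    (genPencil n).adjugate.map derivative := rfl
  rw [h'] at h
  rw [h]
  simp [Polynomial.derivative']

lemma trace_adjugate_Z :
    ((genPencil n).adjugate * (matZ n).map C).trace = derivative (genPencil n).det := by
  have h := derivation_det (Polynomial.derivative' (R := PolyWZ n)) (genPencil n)
  rw [genPencil_map_derivative] at h
  exact h.symm

lemma map_C_matW : (matW n).map C = genPencil n - (X : (PolyWZ n)[X]) • (matZ n).map C := by
  simp [pencil]

lemma trace_adjugate_W :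
    ((genPencil n).adjugate * (matW n).map C).trace =
      (n : (PolyWZ n)[X]) * (genPencil n).det - X * derivative (genPencil n).det := by
  rw [map_C_matW, mul_sub, Matrix.adjugate_mul, Matrix.mul_smul, Matrix.trace_sub,
    Matrix.trace_smul, Matrix.trace_smul, trace_adjugate_Z, Matrix.trace_one]
  simp [mul_comm]

lemma adjugate_W_adjugate :
    (genPencil n).adjugate * (matW n).map C * (genPencil n).adjugate =
      (genPencil n).det • (genPencil n).adjugate -
        (X : (PolyWZ n)[X]) • (derivative (genPencil n).det • (genPencil n).adjugate -
        (genPencil n).det • (genPencil n).adjugate.map derivative) := by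
  rw [map_C_matW, mul_sub, sub_mul, Matrix.adjugate_mul, Matrix.mul_smul, Matrix.smul_mul,
    Matrix.smul_mul, adjugate_Z_adjugate, one_mul]

lemma mul_mul_apply_sum {ι S : Type*} [Fintype ι] [CommRing S] (A N B : Matrix ι ι S) (p q : ι) :
    (A * N * B) p q = ∑ i, ∑ j, N i j * (A p i * B j q) := by
  rw [Matrix.mul_apply]
  simp only [Matrix.mul_apply, Finset.sum_mul]
  rw [Finset.sum_comm]
  exact Finset.sum_congr rfl fun i _ => Finset.sum_congr rfl fun j _ => by ring

lemma trace_mul_sum {ι S : Type*} [Fintype ι] [CommRing S] (A N : Matrix ι ι S) :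
    (A * N).trace = ∑ i, ∑ j, N i j * A j i := by
  simp only [Matrix.trace, Matrix.diag_apply, Matrix.mul_apply]
  rw [Finset.sum_comm]
  exact Finset.sum_congr rfl fun i _ => Finset.sum_congr rfl fun j _ => mul_comm _ _

/-- Derivatives of the adjugate are known only after multiplication by the determinant, which can be
cancelled in this domain. Contracting the minors with `W` leaves `adj W adj - tr(adj W) adj`. -/
lemma sum_derivW_derivW_det (s t : Fin n) :
    ∑ i, ∑ j, C (matW n i j) *
        coeffDerivation (derivW i t) (coeffDerivation (derivW s j) (genPencil n).det) =
      (1 - (n : (PolyWZ n)[X])) * (genPencil n).adjugate t s + X * derivative ((genPencil n).adjugate t s) := by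
  refine mul_left_cancel₀ (genPencil_det_ne_zero (n := n)) ?_
  have h₁ := congrFun (congrFun (adjugate_W_adjugate (n := n)) t) s
  have h₂ := trace_adjugate_W (n := n)
  rw [mul_mul_apply_sum] at h₁
  rw [trace_mul_sum] at h₂
  simp only [Matrix.map_apply, Matrix.sub_apply, Matrix.smul_apply, smul_eq_mul] at h₁ h₂
  simp only [derivW_det, Finset.mul_sum]
  have h₃ : ∀ i j : Fin n, (genPencil n).det * (C (matW n i j) *
      coeffDerivation (derivW i t) ((genPencil n).adjugate j s)) =
      C (matW n i j) * ((genPencil n).adjugate t i * (genPencil n).adjugate j s) -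
      C (matW n i j) * (genPencil n).adjugate j i * (genPencil n).adjugate t s := by
    intro i j
    linear_combination C (matW n i j) * det_mul_derivW_adjugate i t j s
  simp only [h₃, Finset.sum_sub_distrib, ← Finset.sum_mul]
  rw [h₁, h₂]
  ring

lemma sum_derivZ_derivZ_det (s t : Fin n) :
    ∑ i, ∑ j, C (matZ n i j) *
        coeffDerivation (derivZ i t) (coeffDerivation (derivZ s j) (genPencil n).det) =
      -(X * (X * derivative ((genPencil n).adjugate t s))) := by
  refine mul_left_cancel₀ (genPencil_det_ne_zero (n := n)) ?_
  have h₁ := congrFun (congrFun (adjugate_Z_adjugate (n := n)) t) s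
  have h₂ := trace_adjugate_Z (n := n)
  rw [mul_mul_apply_sum] at h₁
  rw [trace_mul_sum] at h₂
  simp only [Matrix.map_apply, Matrix.sub_apply, Matrix.smul_apply, smul_eq_mul] at h₁ h₂
  simp only [derivZ_det, Finset.mul_sum, Derivation.leibniz, coeffDerivation_X, smul_eq_mul,
    mul_zero, add_zero]
  have h₃ : ∀ i j : Fin n, (genPencil n).det * (C (matZ n i j) *
      (X * coeffDerivation (derivZ i t) ((genPencil n).adjugate j s))) =
      X * X * (C (matZ n i j) * ((genPencil n).adjugate t i * (genPencil n).adjugate j s)) -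
      X * X * (C (matZ n i j) * (genPencil n).adjugate j i) * (genPencil n).adjugate t s := by
    intro i j
    linear_combination C (matZ n i j) * X * det_mul_derivZ_adjugate i t j s
  simp only [h₃, Finset.sum_sub_distrib, ← Finset.sum_mul, ← Finset.mul_sum]
  rw [h₁, h₂]
  ring

/-- The coefficient matrix of `λ^a` in the adjugate of the generic pencil. -/
abbrev genAdj (n a : ℕ) : Matrix (Fin n) (Fin n) (PolyWZ n) := adjCoeff (matW n) (matZ n) a

lemma derivW_polyQ (s t : Fin n) (a : ℕ) : derivW s t (polyQ n a) = genAdj n a t s := by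
  have h := congrArg (fun p => p.coeff a) (derivW_det s t)
  exact h

lemma derivZ_polyQ_zero (s t : Fin n) : derivZ s t (polyQ n 0) = 0 := by
  have h := congrArg (fun p => p.coeff 0) (derivZ_det s t)
  simp only [coeff_coeffDerivation, coeff_X_mul_zero] at h
  exact h

lemma derivZ_polyQ_succ (s t : Fin n) (a : ℕ) :
    derivZ s t (polyQ n (a + 1)) = genAdj n a t s := by
  have h := congrArg (fun p => p.coeff (a + 1)) (derivZ_det s t)
  simp only [coeff_coeffDerivation, coeff_X_mul] at h
  exact h

lemma sum_derivW_derivW_polyQ (s t : Fin n) (a : ℕ) :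
    ∑ i, ∑ j, matW n i j * derivW i t (derivW s j (polyQ n a)) =
      (1 - (n : PolyWZ n) + a) * genAdj n a t s := by
  have h := congrArg (fun p => p.coeff a) (sum_derivW_derivW_det s t)
  have h' : (1 - (n : (PolyWZ n)[X])) = C (1 - (n : PolyWZ n)) := by simp
  simp only [finsetSum_coeff, coeff_C_mul, coeff_coeffDerivation, coeff_add, h'] at h
  rw [polyQ_eq_detCoeff]
  refine h.trans ?_
  cases a with
  | zero => simp [adjCoeff]
  | succ a =>
    rw [coeff_X_mul, coeff_derivative]
    simp only [adjCoeff, Matrix.of_apply]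
    push_cast
    ring

lemma sum_derivZ_derivZ_polyQ_zero (s t : Fin n) :
    ∑ i, ∑ j, matZ n i j * derivZ i t (derivZ s j (polyQ n 0)) = 0 := by
  simp [derivZ_polyQ_zero]

lemma sum_derivZ_derivZ_polyQ_succ (s t : Fin n) (a : ℕ) :
    ∑ i, ∑ j, matZ n i j * derivZ i t (derivZ s j (polyQ n (a + 1))) =
      -(a * genAdj n a t s) := by
  have h := congrArg (fun p => p.coeff (a + 1)) (sum_derivZ_derivZ_det s t)
  simp only [finsetSum_coeff, coeff_C_mul, coeff_coeffDerivation, coeff_neg, coeff_X_mul] at h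
  rw [polyQ_eq_detCoeff]
  refine h.trans ?_
  cases a with
  | zero => simp
  | succ a =>
    rw [coeff_X_mul, coeff_derivative]
    simp only [adjCoeff, Matrix.of_apply]
    push_cast
    ring

/-- `tr ((W + Z) A_c)` is a linear combination of the `Q_a`. -/
lemma sum_W_add_Z_mul_genAdj (c : ℕ) :
    ∑ s, ∑ t, (matW n s t + matZ n s t) * genAdj n c t s =
      ((n : PolyWZ n) - c) * polyQ n c + (c + 1) * polyQ n (c + 1) := by
  have h₁ := congrArg (fun p => p.coeff c) (trace_adjugate_W (n := n))
  have h₂ := congrArg (fun p => p.coeff c) (trace_adjugate_Z (n := n))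
  have h' : (n : (PolyWZ n)[X]) = C (n : PolyWZ n) := by simp
  rw [trace_mul_sum] at h₁ h₂
  simp only [finsetSum_coeff, Matrix.map_apply, coeff_C_mul, coeff_sub, h', coeff_derivative]
    at h₁ h₂
  simp only [add_mul, Finset.sum_add_distrib]
  refine (congrArg₂ (· + ·) h₁ h₂).trans ?_
  simp only [polyQ_eq_detCoeff]
  cases c with
  | zero =>
    simp [detCoeff]
  | succ c =>
    rw [coeff_X_mul, coeff_derivative]
    simp only [detCoeff]
    push_cast
    ring

end PartialDerivatives

/-! The chain rule for polynomials in several variables. -/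

section ChainRule

open MvPolynomial

variable {σ 𝕜 A : Type*} [CommRing 𝕜] [CommRing A] [Algebra 𝕜 A]

lemma pderiv_pderiv_comm (i j : σ) (p : MvPolynomial σ 𝕜) :
    pderiv i (pderiv j p) = pderiv j (pderiv i p) := by
  classical
  have h : ⁅(pderiv i : Derivation 𝕜 (MvPolynomial σ 𝕜) (MvPolynomial σ 𝕜)),
      (pderiv j : Derivation 𝕜 (MvPolynomial σ 𝕜) (MvPolynomial σ 𝕜))⁆ = 0 := by
    refine derivation_ext fun k => ?_
    rw [Derivation.commutator_apply, pderiv_X, pderiv_X, Derivation.zero_apply]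
    by_cases hi : k = i <;> by_cases hj : k = j <;> simp [hi, hj, Pi.single_apply] <;>
      split_ifs <;> simp
  have h' := congrArg (fun D : Derivation 𝕜 _ _ => D p) h
  simp only [Derivation.commutator_apply, Derivation.zero_apply] at h'
  exact sub_eq_zero.1 h'

variable [Fintype σ]

lemma derivation_mvAeval (D : Derivation 𝕜 A A) (f : σ → A) (p : MvPolynomial σ 𝕜) :
    D (aeval f p) = ∑ i, aeval f (pderiv i p) * D (f i) := by
  classical
  induction p using MvPolynomial.induction_on with
  | C a => simp
  | add p q hp hq => simp only [map_add, hp, hq, add_mul, Finset.sum_add_distrib]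
  | mul_X p j hp =>
    have h : ∀ i, aeval f (pderiv i (p * X j)) * D (f i) =
        aeval f p * (if i = j then D (f i) else 0) +
          f j * (aeval f (pderiv i p) * D (f i)) := by
      intro i
      rw [Derivation.leibniz, pderiv_X]
      by_cases hij : i = j
      · subst hij
        simp
        ring
      · simp [Ne.symm hij, hij]
        ring
    simp only [h, Finset.sum_add_distrib, ← Finset.mul_sum, ← hp]
    rw [Finset.sum_ite_eq' Finset.univ j, if_pos (Finset.mem_univ j), map_mul, aeval_X,
      Derivation.leibniz, smul_eq_mul, smul_eq_mul]

lemma derivation_derivation_mvAeval (D₁ D₂ : Derivation 𝕜 A A) (f : σ → A)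
    (p : MvPolynomial σ 𝕜) :
    D₁ (D₂ (aeval f p)) =
      ∑ i, ∑ j, aeval f (pderiv j (pderiv i p)) * (D₁ (f j) * D₂ (f i)) +
        ∑ i, aeval f (pderiv i p) * D₁ (D₂ (f i)) := by
  rw [derivation_mvAeval, map_sum, ← Finset.sum_add_distrib]
  refine Finset.sum_congr rfl fun i _ => ?_
  rw [Derivation.leibniz, derivation_mvAeval, smul_eq_mul, smul_eq_mul, Finset.mul_sum, add_comm]
  congr 1
  exact Finset.sum_congr rfl fun j _ => by ring

end ChainRule

/-! The operators on `ℂ[W, Z]` that correspond to the Laplacians on `ℂ[X, Y]`. -/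

section RadialPart

variable {n : ℕ}

/-- The operator on `ℂ[W, Z]` that corresponds to `Δ_{s,t}` on `ℂ[X, Y]`. -/
def radialPart (k₁ k₂ : ℕ) (s t : Fin n) (Q : PolyWZ n) : PolyWZ n :=
  k₁ * derivW s t Q + ∑ i, ∑ j, matW n i j * derivW i t (derivW s j Q) +
    (k₂ * derivZ s t Q + ∑ i, ∑ j, matZ n i j * derivZ i t (derivZ s j Q))

/-- The entry `(X' ᵗY')_p`, where `X'` and `Y'` consist of the columns `f j`. -/
def blockProd {κ ι : Type} [Fintype ι] (f : ι → κ) (p : Fin n × Fin n) : PolyXY n κ :=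
  ∑ u, MvPolynomial.X (Sum.inl (p.1, f u)) * MvPolynomial.X (Sum.inr (p.2, f u))

lemma pullback_eq_aeval (k₁ k₂ : ℕ) : pullback n k₁ k₂ =
    MvPolynomial.aeval (Sum.elim (blockProd (Sum.inl : Fin k₁ → Fin k₁ ⊕ Fin k₂))
      (blockProd (Sum.inr : Fin k₂ → Fin k₁ ⊕ Fin k₂))) := by
  rfl

lemma pullback_matW (k₁ k₂ : ℕ) (i j : Fin n) :
    pullback n k₁ k₂ (matW n i j) = blockProd Sum.inl (i, j) := by
  rw [pullback_eq_aeval, matW, Matrix.of_apply, MvPolynomial.aeval_X, Sum.elim_inl]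

lemma pullback_matZ (k₁ k₂ : ℕ) (i j : Fin n) :
    pullback n k₁ k₂ (matZ n i j) = blockProd Sum.inr (i, j) := by
  rw [pullback_eq_aeval, matZ, Matrix.of_apply, MvPolynomial.aeval_X, Sum.elim_inr]

section BlockProd

variable {κ ι : Type} [Fintype ι] {f : ι → κ}

lemma pderiv_inl_blockProd (hf : Function.Injective f) (s : Fin n) (u : ι) (p : Fin n × Fin n) :
    MvPolynomial.pderiv (Sum.inl (s, f u)) (blockProd f p) =
      if p.1 = s then MvPolynomial.X (Sum.inr (p.2, f u)) else 0 := by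
  classical
  rw [blockProd, map_sum, Finset.sum_eq_single u]
  · by_cases h : p.1 = s <;>
      simp [Derivation.leibniz, MvPolynomial.pderiv_X, h]
  · intro v _ hv
    simp [Derivation.leibniz, MvPolynomial.pderiv_X, hf.ne hv]
  · simp

lemma pderiv_inr_blockProd (hf : Function.Injective f) (t : Fin n) (u : ι) (p : Fin n × Fin n) :
    MvPolynomial.pderiv (Sum.inr (t, f u)) (blockProd f p) =
      if p.2 = t then MvPolynomial.X (Sum.inl (p.1, f u)) else 0 := by
  classical
  rw [blockProd, map_sum, Finset.sum_eq_single u]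
  · by_cases h : p.2 = t <;>
      simp [Derivation.leibniz, MvPolynomial.pderiv_X, h]
  · intro v _ hv
    simp [Derivation.leibniz, MvPolynomial.pderiv_X, hf.ne hv]
  · simp

lemma pderiv_inl_blockProd_of_notMem (s : Fin n) {w : κ} (hw : w ∉ Set.range f)
    (p : Fin n × Fin n) : MvPolynomial.pderiv (Sum.inl (s, w)) (blockProd f p) = 0 := by
  classical
  rw [blockProd, map_sum]
  refine Finset.sum_eq_zero fun v _ => ?_
  have h : f v ≠ w := fun h => hw ⟨v, h⟩
  simp [Derivation.leibniz, MvPolynomial.pderiv_X, h]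

lemma pderiv_inr_blockProd_of_notMem (t : Fin n) {w : κ} (hw : w ∉ Set.range f)
    (p : Fin n × Fin n) : MvPolynomial.pderiv (Sum.inr (t, w)) (blockProd f p) = 0 := by
  classical
  rw [blockProd, map_sum]
  refine Finset.sum_eq_zero fun v _ => ?_
  have h : f v ≠ w := fun h => hw ⟨v, h⟩
  simp [Derivation.leibniz, MvPolynomial.pderiv_X, h]

end BlockProd

lemma pderiv_inl_X_inl {κ : Type} [DecidableEq κ] (s i : Fin n) (u : κ) :
    MvPolynomial.pderiv (Sum.inl (s, u)) (MvPolynomial.X (Sum.inl (i, u)) : PolyXY n κ) =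
      if i = s then 1 else 0 := by
  classical
  simp [MvPolynomial.pderiv_X, Pi.single_apply]

/-- Models `∂/∂x_{s,u}` and `∂/∂y_{t,u}` for one column `u`. That column contributes a rank-one
matrix to the block selected by `e` and nothing to the other block; the single first-order term
comes from `∂x_{i,u}/∂x_{s,u} = δ`. -/
lemma derivation_derivation_mvAeval_of_rank_one {σ A : Type*} [Fintype σ] [CommRing A]
    [Algebra ℂ A] {e : Fin n × Fin n → σ} (he : Function.Injective e) (D₁ D₂ : Derivation ℂ A A)
    (g : σ → A) (s t : Fin n) (x y : Fin n → A)
    (h₁ : ∀ p, D₁ (g (e p)) = if p.1 = s then y p.2 else 0)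
    (h₂ : ∀ p, D₂ (g (e p)) = if p.2 = t then x p.1 else 0)
    (h₁' : ∀ k ∉ Set.range e, D₁ (g k) = 0) (h₂' : ∀ k ∉ Set.range e, D₂ (g k) = 0)
    (hx : ∀ i, D₁ (x i) = if i = s then 1 else 0) (Q : MvPolynomial σ ℂ) :
    D₁ (D₂ (MvPolynomial.aeval g Q)) =
      ∑ i, ∑ j, MvPolynomial.aeval g (MvPolynomial.pderiv (e (i, t))
        (MvPolynomial.pderiv (e (s, j)) Q)) * (x i * y j) +
      MvPolynomial.aeval g (MvPolynomial.pderiv (e (s, t)) Q) := by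
  rw [derivation_derivation_mvAeval]
  congr 1
  · rw [← Fintype.sum_of_injective e he (fun p => ∑ q : Fin n × Fin n,
      MvPolynomial.aeval g (MvPolynomial.pderiv (e q) (MvPolynomial.pderiv (e p) Q)) *
        ((if q.1 = s then y q.2 else 0) * (if p.2 = t then x p.1 else 0)))]
    · rw [Fintype.sum_prod_type]
      refine Finset.sum_congr rfl fun i _ => ?_
      rw [Finset.sum_eq_single t]
      · rw [Fintype.sum_prod_type, Finset.sum_eq_single s]
        · refine Finset.sum_congr rfl fun j _ => ?_
          rw [if_pos rfl, if_pos rfl, pderiv_pderiv_comm, mul_comm (y j)]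
        · intro b _ hb
          simp [hb]
        · simp
      · intro b _ hb
        simp [hb]
      · simp
    · intro k hk
      simp [h₂' k hk]
    · intro p
      refine Fintype.sum_of_injective e he _ _ ?_ ?_
      · intro k hk
        rw [h₁' k hk, zero_mul, mul_zero]
      · intro q
        rw [h₁, h₂]
  · rw [← Fintype.sum_of_injective e he (fun p => MvPolynomial.aeval g
      (MvPolynomial.pderiv (e p) Q) * (if p.2 = t then if p.1 = s then 1 else 0 else 0))]
    · rw [Finset.sum_eq_single (s, t)]
      · simp
      · intro p _ hp
        by_cases h : p.2 = t
        · have : p.1 ≠ s := fun h' => hp (Prod.ext h' h)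
          simp [this]
        · simp [h]
      · simp
    · intro k hk
      rw [h₂' k hk, map_zero, mul_zero]
    · intro p
      rw [h₂, apply_ite D₁, hx, map_zero]

lemma pderiv_pderiv_pullback_left (k₁ k₂ : ℕ) (s t : Fin n) (Q : PolyWZ n) (u : Fin k₁) :
    MvPolynomial.pderiv (Sum.inl (s, Sum.inl u))
        (MvPolynomial.pderiv (Sum.inr (t, Sum.inl u)) (pullback n k₁ k₂ Q)) =
      ∑ i, ∑ j, pullback n k₁ k₂ (derivW i t (derivW s j Q)) *
          (MvPolynomial.X (Sum.inl (i, Sum.inl u)) * MvPolynomial.X (Sum.inr (j, Sum.inl u))) +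
        pullback n k₁ k₂ (derivW s t Q) := by
  have hr : (Sum.inl u : Fin k₁ ⊕ Fin k₂) ∉ Set.range Sum.inr := by simp
  rw [pullback_eq_aeval]
  refine derivation_derivation_mvAeval_of_rank_one (e := Sum.inl) Sum.inl_injective _ _ _ s t
    (fun i => MvPolynomial.X (Sum.inl (i, Sum.inl u)))
    (fun j => MvPolynomial.X (Sum.inr (j, Sum.inl u)))
    (pderiv_inl_blockProd Sum.inl_injective s u) (pderiv_inr_blockProd Sum.inl_injective t u)
    ?_ ?_ (fun i => pderiv_inl_X_inl s i _) Q
  · rintro (p | p) hp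
    · simp at hp
    · exact pderiv_inl_blockProd_of_notMem s hr p
  · rintro (p | p) hp
    · simp at hp
    · exact pderiv_inr_blockProd_of_notMem t hr p

lemma pderiv_pderiv_pullback_right (k₁ k₂ : ℕ) (s t : Fin n) (Q : PolyWZ n) (u : Fin k₂) :
    MvPolynomial.pderiv (Sum.inl (s, Sum.inr u))
        (MvPolynomial.pderiv (Sum.inr (t, Sum.inr u)) (pullback n k₁ k₂ Q)) =
      ∑ i, ∑ j, pullback n k₁ k₂ (derivZ i t (derivZ s j Q)) *
          (MvPolynomial.X (Sum.inl (i, Sum.inr u)) * MvPolynomial.X (Sum.inr (j, Sum.inr u))) +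
        pullback n k₁ k₂ (derivZ s t Q) := by
  have hr : (Sum.inr u : Fin k₁ ⊕ Fin k₂) ∉ Set.range Sum.inl := by simp
  rw [pullback_eq_aeval]
  refine derivation_derivation_mvAeval_of_rank_one (e := Sum.inr) Sum.inr_injective _ _ _ s t
    (fun i => MvPolynomial.X (Sum.inl (i, Sum.inr u)))
    (fun j => MvPolynomial.X (Sum.inr (j, Sum.inr u)))
    (pderiv_inl_blockProd Sum.inr_injective s u) (pderiv_inr_blockProd Sum.inr_injective t u)
    ?_ ?_ (fun i => pderiv_inl_X_inl s i _) Q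
  · rintro (p | p) hp
    · exact pderiv_inl_blockProd_of_notMem s hr p
    · simp at hp
  · rintro (p | p) hp
    · exact pderiv_inr_blockProd_of_notMem t hr p
    · simp at hp

/-- Summed over columns, the products `x_{i,u} y_{j,u}` assemble to the entries of `W` and `Z`,
while the first-order term is the same for every column of a block and so is counted `k₁` or `k₂`
times. -/
lemma laplacian_pullback (k₁ k₂ : ℕ) (s t : Fin n) (Q : PolyWZ n) :
    laplacian s t (pullback n k₁ k₂ Q) = pullback n k₁ k₂ (radialPart k₁ k₂ s t Q) := by
  simp only [radialPart, map_add, map_mul, map_natCast, map_sum, pullback_matW, pullback_matZ]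
  simp only [laplacian, Fintype.sum_sum_type, pderiv_pderiv_pullback_left,
    pderiv_pderiv_pullback_right, Finset.sum_add_distrib, Finset.sum_const,
    Finset.card_univ, Fintype.card_fin, nsmul_eq_mul]
  have h : ∀ {k : ℕ} (g : Fin n → Fin n → PolyXY n (Fin k₁ ⊕ Fin k₂))
      (f : Fin k → Fin k₁ ⊕ Fin k₂),
      ∑ u, ∑ i, ∑ j, g i j * (MvPolynomial.X (Sum.inl (i, f u)) *
        MvPolynomial.X (Sum.inr (j, f u))) = ∑ i, ∑ j, blockProd f (i, j) * g i j := by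
    intro k g f
    rw [Finset.sum_comm]
    refine Finset.sum_congr rfl fun i _ => ?_
    rw [Finset.sum_comm]
    refine Finset.sum_congr rfl fun j _ => ?_
    rw [blockProd, Finset.sum_mul]
    exact Finset.sum_congr rfl fun _ _ => mul_comm _ _
  rw [h, h]
  ring

/-- The substitution `X_a ↦ Q_a`. -/
def substQ (n : ℕ) : MvPolynomial (Fin (n + 1)) ℂ →ₐ[ℂ] PolyWZ n :=
  MvPolynomial.aeval fun a => polyQ n a

/-- The variable `X_e`, or zero if `e > n`. -/
def varExt (n e : ℕ) : MvPolynomial (Fin (n + 1)) ℂ :=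
  if h : e < n + 1 then MvPolynomial.X ⟨e, h⟩ else 0

lemma substQ_varExt (n e : ℕ) : substQ n (varExt n e) = polyQ n e := by
  unfold varExt
  split_ifs with h
  · rw [substQ, MvPolynomial.aeval_X]
  · rw [map_zero, polyQ_eq_detCoeff, detCoeff_eq_zero_of_lt]
    simpa using h

/-- The coefficient operators of the radial parts in the coordinates `Q_0, …, Q_n`. -/
def coordOp (k₁ k₂ c : ℕ) (q : MvPolynomial (Fin (n + 1)) ℂ) : MvPolynomial (Fin (n + 1)) ℂ :=
  ∑ a : Fin (n + 1), (if (a : ℕ) = c then (k₁ + 1 - n + c : MvPolynomial (Fin (n + 1)) ℂ) else 0) *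
      MvPolynomial.pderiv a q +
    ∑ a : Fin (n + 1), (if (a : ℕ) = c + 1 then (k₂ - c : MvPolynomial (Fin (n + 1)) ℂ) else 0) *
      MvPolynomial.pderiv a q +
    ∑ a : Fin (n + 1), ∑ b : Fin (n + 1), (pencilSign b a c : MvPolynomial (Fin (n + 1)) ℂ) *
      -- The guards exclude the indices at which truncated subtraction would produce a spurious
      -- `X_0`.
      ((if c < (b : ℕ) + a + 1 then varExt n (b + a - c) else 0) -
        (if c < (b : ℕ) + a then varExt n (b + a - 1 - c) else 0)) *
      MvPolynomial.pderiv b (MvPolynomial.pderiv a q)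

lemma sum_range_eq_sum_range_ite {M : Type*} [AddCommMonoid M] {m N : ℕ} (h : m ≤ N) (f : ℕ → M) :
    ∑ c ∈ Finset.range m, f c = ∑ c ∈ Finset.range N, if c < m then f c else 0 := by
  rw [← Finset.sum_filter]
  refine Finset.sum_congr ?_ fun _ _ => rfl
  ext c
  simp only [Finset.mem_range, Finset.mem_filter]
  omega

lemma sum_sum_sum_comm {ι κ M : Type*} [Fintype ι] [AddCommMonoid M] (s : Finset κ)
    (f : ι → ι → κ → M) : ∑ i, ∑ j, ∑ a ∈ s, f i j a = ∑ a ∈ s, ∑ i, ∑ j, f i j a :=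
  (Finset.sum_congr rfl fun _ _ => Finset.sum_comm).trans Finset.sum_comm

lemma sum_matW_mul_derivW_mul_derivW (s t : Fin n) (a b : Fin (n + 1)) :
    ∑ i, ∑ j, matW n i j * (derivW i t (polyQ n b) * derivW s j (polyQ n a)) =
      ∑ c ∈ Finset.range (2 * n + 1), (pencilSign b a c : PolyWZ n) *
        (if c < (b : ℕ) + a + 1 then polyQ n (b + a - c) else 0) * genAdj n c t s := by
  have h := congrFun (congrFun (adjCoeff_mul_W_mul_adjCoeff (matW n) (matZ n) b a) t) s
  rw [mul_mul_apply_sum, sum_range_eq_sum_range_ite (N := 2 * n + 1) (by omega)] at h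
  simp only [derivW_polyQ]
  rw [h, Matrix.sum_apply]
  refine Finset.sum_congr rfl fun c _ => ?_
  split_ifs
  · simp [polyQ_eq_detCoeff, mul_assoc]
  · simp

lemma sum_matZ_mul_derivZ_mul_derivZ (s t : Fin n) (a b : Fin (n + 1)) :
    ∑ i, ∑ j, matZ n i j * (derivZ i t (polyQ n b) * derivZ s j (polyQ n a)) =
      -∑ c ∈ Finset.range (2 * n + 1), (pencilSign b a c : PolyWZ n) *
        (if c < (b : ℕ) + a then polyQ n (b + a - 1 - c) else 0) * genAdj n c t s := by
  obtain ⟨a, ha⟩ := a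
  obtain ⟨b, hb⟩ := b
  simp only
  rcases a with _ | a
  · simp only [derivZ_polyQ_zero, mul_zero, Finset.sum_const_zero]
    rw [Finset.sum_eq_zero, neg_zero]
    intro c _
    split_ifs with h
    · have : ¬ b ≤ c := by omega
      simp [pencilSign, this]
    · simp
  rcases b with _ | b
  · simp only [derivZ_polyQ_zero, zero_mul, mul_zero, Finset.sum_const_zero]
    rw [Finset.sum_eq_zero, neg_zero]
    intro c _
    split_ifs with h
    · have : ¬ a + 1 ≤ c := by omega
      simp [pencilSign, this]
    · simp
  have h := congrFun (congrFun (adjCoeff_mul_Z_mul_adjCoeff (matW n) (matZ n) b a) t) s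
  rw [mul_mul_apply_sum, sum_range_eq_sum_range_ite (N := 2 * n + 1) (by omega)] at h
  simp only [derivZ_polyQ_succ]
  rw [h, Matrix.neg_apply, Matrix.sum_apply]
  congr 1
  refine Finset.sum_congr rfl fun c _ => ?_
  rw [show b + 1 + (a + 1) = b + a + 2 by ring, show b + a + 2 - 1 - c = b + a + 1 - c by omega]
  split_ifs
  · simp [polyQ_eq_detCoeff, mul_assoc]
  · simp

/-- The chain rule reduces the claim to first- and second-order expressions in the `Q_a`, each
already expanded in the `A_c`. Since `a, b ≤ n`, the range `c ≤ 2n` suffices. -/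
lemma radialPart_substQ (k₁ k₂ : ℕ) (s t : Fin n) (q : MvPolynomial (Fin (n + 1)) ℂ) :
    radialPart k₁ k₂ s t (substQ n q) =
      ∑ c ∈ Finset.range (2 * n + 1), substQ n (coordOp k₁ k₂ c q) * genAdj n c t s := by
  have hw : ∀ a : Fin (n + 1), (k₁ : PolyWZ n) * derivW s t (polyQ n a) +
      ∑ i, ∑ j, matW n i j * derivW i t (derivW s j (polyQ n a)) =
      ∑ c ∈ Finset.range (2 * n + 1),
        (if (a : ℕ) = c then (k₁ + 1 - n + c : PolyWZ n) else 0) * genAdj n c t s := by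
    intro a
    rw [sum_derivW_derivW_polyQ, derivW_polyQ]
    simp only [ite_mul, zero_mul]
    rw [Finset.sum_ite_eq, if_pos (Finset.mem_range.2 (by omega))]
    ring
  have hz : ∀ a : Fin (n + 1), (k₂ : PolyWZ n) * derivZ s t (polyQ n a) +
      ∑ i, ∑ j, matZ n i j * derivZ i t (derivZ s j (polyQ n a)) =
      ∑ c ∈ Finset.range (2 * n + 1),
        (if (a : ℕ) = c + 1 then (k₂ - c : PolyWZ n) else 0) * genAdj n c t s := by
    rintro ⟨a, ha⟩
    simp only
    rcases a with _ | a
    · rw [sum_derivZ_derivZ_polyQ_zero, derivZ_polyQ_zero]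
      simp
    · rw [sum_derivZ_derivZ_polyQ_succ, derivZ_polyQ_succ]
      simp only [ite_mul, zero_mul, Nat.add_right_cancel_iff]
      rw [Finset.sum_ite_eq, if_pos (Finset.mem_range.2 (by omega))]
      ring
  have second : ∀ (M : Matrix (Fin n) (Fin n) (PolyWZ n))
      (D : Fin n → Fin n → Derivation ℂ (PolyWZ n) (PolyWZ n)),
      ∑ i, ∑ j, M i j * D i t (D s j (substQ n q)) =
      ∑ a : Fin (n + 1), ∑ b : Fin (n + 1),
          substQ n (MvPolynomial.pderiv b (MvPolynomial.pderiv a q)) *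
            ∑ i, ∑ j, M i j * (D i t (polyQ n b) * D s j (polyQ n a)) +
        ∑ a : Fin (n + 1), substQ n (MvPolynomial.pderiv a q) *
          ∑ i, ∑ j, M i j * D i t (D s j (polyQ n a)) := by
    intro M D
    simp only [substQ, derivation_derivation_mvAeval, mul_add, Finset.sum_add_distrib,
      Finset.mul_sum]
    congr 1
    · rw [sum_sum_sum_comm]
      refine Finset.sum_congr rfl fun a _ => ?_
      rw [sum_sum_sum_comm]
      exact Finset.sum_congr rfl fun b _ =>
        Finset.sum_congr rfl fun i _ => Finset.sum_congr rfl fun j _ => by ring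
    · rw [sum_sum_sum_comm]
      exact Finset.sum_congr rfl fun a _ =>
        Finset.sum_congr rfl fun i _ => Finset.sum_congr rfl fun j _ => by ring
  have first : ∀ D : Derivation ℂ (PolyWZ n) (PolyWZ n), D (substQ n q) =
      ∑ a : Fin (n + 1), substQ n (MvPolynomial.pderiv a q) * D (polyQ n a) := fun D =>
    derivation_mvAeval _ _ _
  have total : radialPart k₁ k₂ s t (substQ n q) =
      ∑ a : Fin (n + 1), substQ n (MvPolynomial.pderiv a q) *
          ((k₁ : PolyWZ n) * derivW s t (polyQ n a) +
            ∑ i, ∑ j, matW n i j * derivW i t (derivW s j (polyQ n a))) +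
        ∑ a : Fin (n + 1), substQ n (MvPolynomial.pderiv a q) *
          ((k₂ : PolyWZ n) * derivZ s t (polyQ n a) +
            ∑ i, ∑ j, matZ n i j * derivZ i t (derivZ s j (polyQ n a))) +
        ∑ a : Fin (n + 1), ∑ b : Fin (n + 1),
          substQ n (MvPolynomial.pderiv b (MvPolynomial.pderiv a q)) *
            (∑ i, ∑ j, matW n i j * (derivW i t (polyQ n b) * derivW s j (polyQ n a)) +
              ∑ i, ∑ j, matZ n i j * (derivZ i t (polyQ n b) * derivZ s j (polyQ n a))) := by
    rw [radialPart, second (matW n) derivW, second (matZ n) derivZ, first, first]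
    simp only [mul_add, Finset.sum_add_distrib, Finset.mul_sum, mul_left_comm (substQ n _)]
    ring
  rw [total]
  simp only [hw, hz, sum_matW_mul_derivW_mul_derivW, sum_matZ_mul_derivZ_mul_derivZ,
    ← sub_eq_add_neg, ← Finset.sum_sub_distrib]
  simp only [coordOp, map_add, map_sum, map_mul, add_mul, Finset.sum_add_distrib,
    Finset.sum_mul, Finset.mul_sum, map_sub, apply_ite (substQ n), substQ_varExt, map_natCast,
    map_intCast, map_one, map_zero]
  congr 1
  · congr 1
    · rw [Finset.sum_comm]
      exact Finset.sum_congr rfl fun a _ => Finset.sum_congr rfl fun _ _ => by ring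
    · rw [Finset.sum_comm]
      exact Finset.sum_congr rfl fun a _ => Finset.sum_congr rfl fun _ _ => by ring
  · rw [Finset.sum_comm' (t' := Finset.univ) (s' := fun _ => Finset.range (2 * n + 1))
      (by simp)]
    refine Finset.sum_congr rfl fun a _ => ?_
    rw [Finset.sum_comm]
    exact Finset.sum_congr rfl fun _ _ => Finset.sum_congr rfl fun _ _ => by ring

end RadialPart

/-! Homogeneous polynomials. -/

section Homogeneous

open MvPolynomial

variable {σ 𝕜 A : Type*} [Fintype σ] [CommRing 𝕜] [CommRing A] [Algebra 𝕜 A]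

lemma aeval_const_mul_of_isHomogeneous {f : MvPolynomial σ 𝕜} {v : ℕ} (hf : f.IsHomogeneous v)
    (c : A) (g : σ → A) : aeval (fun i => c * g i) f = c ^ v * aeval g f := by
  rw [aeval_def, aeval_def, eval₂_eq', eval₂_eq', Finset.mul_sum]
  refine Finset.sum_congr rfl fun d hd => ?_
  have hd' : ∑ i, d i = v := by
    rw [← Finsupp.degree_eq_sum]
    exact (hf.degree_eq_sum_deg_support hd).symm
  simp only [mul_pow, Finset.prod_mul_distrib, Finset.prod_pow_eq_pow_sum, hd']
  ring

lemma coeff_aeval_C_mul_X (c : 𝕜) (f : MvPolynomial σ 𝕜) (d : σ →₀ ℕ) :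
    coeff d (aeval (fun i => C c * X i) f : MvPolynomial σ 𝕜) = c ^ d.degree * coeff d f := by
  classical
  induction f using MvPolynomial.induction_on' with
  | monomial e r =>
    have h := aeval_const_mul_of_isHomogeneous (isHomogeneous_monomial r (n := e.degree) rfl)
      (C c : MvPolynomial σ 𝕜) X
    rw [h, aeval_X_left_apply, ← C_pow, coeff_C_mul, coeff_monomial]
    split_ifs with hed
    · rw [hed]
    · simp
  | add p q hp hq => rw [map_add, coeff_add, hp, hq, coeff_add, mul_add]

/-- A single scaling factor is enough, because `d ↦ 2^d` is injective in characteristic zero. -/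
lemma isHomogeneous_of_aeval_two_mul [CharZero 𝕜] [IsDomain 𝕜] {f : MvPolynomial σ 𝕜} {v : ℕ}
    (h : aeval (fun i => C 2 * X i) f = C (2 ^ v) * f) : f.IsHomogeneous v := by
  intro d hd
  have h₁ := congrArg (coeff d) h
  rw [coeff_aeval_C_mul_X, coeff_C_mul] at h₁
  have h₂ : ((2 ^ d.degree : ℕ) : 𝕜) = ((2 ^ v : ℕ) : 𝕜) := by
    push_cast
    exact mul_right_cancel₀ hd h₁
  have h₃ := Nat.pow_right_injective le_rfl (Nat.cast_injective h₂)
  rw [← h₃, Finsupp.degree_eq_weight_one]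
  rfl

end Homogeneous

/-! The canonical form of a pencil. -/

section Canonical

open Polynomial

variable {N : ℕ} {R : Type*} [CommRing R]

/-- The constant part of the canonical pencil with determinant `∑ q_a λ^a`. -/
def canonW (N : ℕ) (q : ℕ → R) : Matrix (Fin (N + 1)) (Fin (N + 1)) R :=
  Matrix.of fun i j => if i = 0 then q j else if j = i then 1 else 0

/-- The linear part of the canonical pencil with determinant `∑ q_a λ^a`. -/
def canonZ (N : ℕ) (q : ℕ → R) : Matrix (Fin (N + 1)) (Fin (N + 1)) R :=
  Matrix.of fun i j => if i = 0 then if (j : ℕ) = N then q (N + 1) else 0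
    else if (j : ℕ) + 1 = i then -1 else 0

/-- The polynomial `∑ q_a λ^a`. -/
def genPoly (N : ℕ) (q : ℕ → R) : R[X] := ∑ a ∈ Finset.range (N + 2), C (q a) * X ^ a

lemma coeff_genPoly (q : ℕ → R) (a : ℕ) :
    (genPoly N q).coeff a = if a < N + 2 then q a else 0 := by
  simp [genPoly, coeff_X_pow]

/-- Row `0` of the pencil is `(q_0, …, q_{N-1}, q_N + λ q_{N+1})` and row `i > 0` is `e_i - λ
e_{i-1}`, so every row but the first annihilates the vector of powers of `λ`. -/
lemma canon_mulVec (q : ℕ → R) :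
    pencil (canonW N q) (canonZ N q) *ᵥ (fun j => X ^ (j : ℕ)) = Pi.single 0 (genPoly N q) := by
  ext1 i
  simp only [Matrix.mulVec, dotProduct, pencil, Matrix.add_apply, Matrix.map_apply,
    Matrix.smul_apply, smul_eq_mul, canonW, canonZ, Matrix.of_apply, add_mul,
    Finset.sum_add_distrib]
  refine Fin.cases ?_ (fun i => ?_) i
  · simp only [if_true, Pi.single_eq_same]
    rw [Fin.sum_univ_eq_sum_range (fun j => C (q j) * X ^ j), genPoly, Finset.sum_range_succ _ (N + 1)]
    congr 1
    rw [Finset.sum_eq_single (Fin.last N)]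
    · simp
      ring
    · intro b _ hb
      have : (b : ℕ) ≠ N := fun h => hb (Fin.ext h)
      simp [this]
    · simp
  · simp only [Fin.succ_ne_zero, if_false, apply_ite C, map_one, map_zero, map_neg, ite_mul,
      zero_mul, one_mul, mul_ite, mul_zero, Finset.sum_ite_eq', Finset.mem_univ, if_true]
    rw [Finset.sum_eq_single i.castSucc]
    · simp
      ring
    · intro b _ hb
      have : (b : ℕ) ≠ i := fun h => hb (Fin.ext h)
      simp [this]
    · simp

/-- Deleting row and column `0` leaves a lower triangular matrix with ones on the diagonal. -/
lemma canon_adjugate_zero_zero (q : ℕ → R) :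
    (pencil (canonW N q) (canonZ N q)).adjugate 0 0 = 1 := by
  rw [Matrix.adjugate_fin_succ_eq_det_submatrix]
  simp only [Fin.val_zero, add_zero, pow_zero, one_mul, Fin.succAbove_zero]
  rw [Matrix.det_of_isLowerTriangular]
  · refine Finset.prod_eq_one fun i _ => ?_
    simp [pencil, canonW, canonZ]
  · intro i j hij
    have hij' : i < j := hij
    have h₁ : j ≠ i := hij'.ne'
    have h₂ : (j : ℕ) + 1 ≠ i := by
      have : (i : ℕ) < j := hij'
      omega
    simp [pencil, canonW, canonZ, h₁, h₂]

lemma adjugate_mul_canon (q : ℕ → R) (j : Fin (N + 1)) :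
    (pencil (canonW N q) (canonZ N q)).det * X ^ (j : ℕ) =
      (pencil (canonW N q) (canonZ N q)).adjugate j 0 * genPoly N q := by
  have h := congrArg (fun M => M *ᵥ (fun j : Fin (N + 1) => (X : R[X]) ^ (j : ℕ)))
    (Matrix.adjugate_mul (pencil (canonW N q) (canonZ N q)))
  simp only [← Matrix.mulVec_mulVec, canon_mulVec, Matrix.smul_mulVec, Matrix.one_mulVec] at h
  have h' := congrFun h j
  rw [Matrix.mulVec_single] at h'
  simpa using h'.symm

lemma canon_det (q : ℕ → R) : (pencil (canonW N q) (canonZ N q)).det = genPoly N q := by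
  have h := adjugate_mul_canon q (0 : Fin (N + 1))
  rwa [canon_adjugate_zero_zero, Fin.val_zero, pow_zero, mul_one, one_mul] at h

lemma detCoeff_canon (q : ℕ → R) (a : ℕ) :
    detCoeff (canonW N q) (canonZ N q) a = if a < N + 2 then q a else 0 := by
  rw [detCoeff, canon_det, coeff_genPoly]

/-- The first column of the adjugate is `(1, λ, …, λ^N)`. This independence of the `A_c` is what
later separates the operators `coordOp c`. -/
lemma adjCoeff_canon [IsDomain R] (q : ℕ → R) (hq : genPoly N q ≠ 0) (c : ℕ)
    (j : Fin (N + 1)) :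
    adjCoeff (canonW N q) (canonZ N q) c j 0 = if c = j then 1 else 0 := by
  have h := adjugate_mul_canon q j
  rw [canon_det, mul_comm] at h
  have h' := mul_right_cancel₀ hq h
  rw [adjCoeff, Matrix.of_apply, ← h', coeff_X_pow]

lemma det_canonZ (q : ℕ → R) : (canonZ N q).det = q (N + 1) := by
  have h : detCoeff (canonW N q) (canonZ N q) (Fintype.card (Fin (N + 1))) =
      (canonZ N q).det := by
    rw [detCoeff, pencil, add_comm ((canonW N q).map C), Polynomial.coeff_det_X_add_C_card]
  rw [← h, detCoeff_canon, Fintype.card_fin, if_pos (by omega)]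

end Canonical

/-! Reduction of a generic pencil to canonical form. -/

section Reduction

variable {N : ℕ} {F : Type*} [Field F]

/-- The matrix whose rows are the first rows of `1, K, K², …`. -/
def krylov {R : Type*} [CommRing R] (K : Matrix (Fin (N + 1)) (Fin (N + 1)) R) :
    Matrix (Fin (N + 1)) (Fin (N + 1)) R :=
  Matrix.of fun i j => (K ^ (i : ℕ)) 0 j

lemma det_krylov_smul {R : Type*} [CommRing R] (c : R)
    (K : Matrix (Fin (N + 1)) (Fin (N + 1)) R) :
    (krylov (c • K)).det = (∏ i : Fin (N + 1), c ^ (i : ℕ)) * (krylov K).det := by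
  rw [← Matrix.det_mul_column]
  congr 1
  ext i j
  simp [krylov, smul_pow]

/-- With `K = -W Z⁻¹`, the vector `e_0` is cyclic for right multiplication by `K`, and in the basis
`e_0 K^i` the pencil takes companion form. The hypothesis uses `W adj(Z)`, a scalar multiple of `K`,
so that it is a polynomial condition. -/
lemma exists_canon_eq (W Z : Matrix (Fin (N + 1)) (Fin (N + 1)) F) (hW : W.det ≠ 0)
    (hZ : Z.det ≠ 0) (hP : (krylov (W * Z.adjugate)).det ≠ 0) :
    ∃ (A B : Matrix (Fin (N + 1)) (Fin (N + 1)) F) (q : ℕ → F), A.det ≠ 0 ∧ B.det ≠ 0 ∧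
      W = A * canonW N q * B ∧ Z = A * canonZ N q * B := by
  have hZu : IsUnit Z.det := isUnit_iff_ne_zero.2 hZ
  set K := (-(Z.det)⁻¹) • (W * Z.adjugate) with hK
  have hKZ : K * Z = -W := by
    rw [hK, Matrix.smul_mul, Matrix.mul_assoc, Matrix.adjugate_mul, Matrix.mul_smul, mul_one,
      smul_smul, neg_mul, inv_mul_cancel₀ hZ, neg_smul, one_smul]
  have hKdet : K.det ≠ 0 := by
    intro h
    have h' := congrArg Matrix.det hKZ
    rw [Matrix.det_mul, h, zero_mul, Matrix.det_neg] at h'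
    exact mul_ne_zero (pow_ne_zero _ (neg_ne_zero.2 one_ne_zero)) hW h'.symm
  set P := krylov K with hPdef
  have hPdet : P.det ≠ 0 := by
    rw [hPdef, hK, det_krylov_smul]
    exact mul_ne_zero (Finset.prod_ne_zero_iff.2 fun i _ =>
      pow_ne_zero _ (neg_ne_zero.2 (inv_ne_zero hZ))) hP
  have hPu : IsUnit P.det := isUnit_iff_ne_zero.2 hPdet
  let x : Fin (N + 1) → F := ((K ^ (N + 1)) 0) ᵥ* P⁻¹
  -- The `x_j` are the coordinates of `e_0 K^{N+1}` in the basis `e_0 K^j`; the entry `-1` at `N +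
  -- 1` makes `∑ q_a e_0 K^a = 0`.
  let q : ℕ → F := fun a => if h : a < N + 1 then x ⟨a, h⟩ else -1
  have hx : x ᵥ* P = (K ^ (N + 1)) 0 := by
    rw [Matrix.vecMul_vecMul, Matrix.nonsing_inv_mul _ hPu, Matrix.vecMul_one]
  have hqx : ∀ j : Fin (N + 1), q j = x j := fun j => dif_pos j.isLt
  have hqN : q (N + 1) = -1 := by simp [q]
  -- Row `0` is the linear relation for `e_0 K^{N+1}`; row `i > 0` is `e_0 K^i = (e_0 K^{i-1}) K`.
  have key : canonW N q * P = -(canonZ N q * P * K) := by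
    ext i j
    rw [Matrix.neg_apply, Matrix.mul_apply, Matrix.mul_apply]
    refine Fin.cases ?_ (fun i => ?_) i
    · have h₁ : ∀ k, (canonZ N q * P) 0 k = -P (Fin.last N) k := by
        intro k
        rw [Matrix.mul_apply, Finset.sum_eq_single (Fin.last N)]
        · simp [canonZ, hqN]
        · intro b _ hb
          have : (b : ℕ) ≠ N := fun h => hb (Fin.ext h)
          simp [canonZ, this]
        · simp
      have h₂ := congrFun hx j
      rw [pow_succ, Matrix.mul_apply] at h₂
      simp only [h₁, canonW, Matrix.of_apply, if_true, hqx, neg_mul, Finset.sum_neg_distrib,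
        neg_neg]
      exact h₂
    · have h₁ : ∀ k, (canonZ N q * P) i.succ k = -P i.castSucc k := by
        intro k
        rw [Matrix.mul_apply, Finset.sum_eq_single i.castSucc]
        · simp [canonZ]
        · intro b _ hb
          have : (b : ℕ) ≠ i := fun h => hb (Fin.ext h)
          simp [canonZ, this]
        · simp
      rw [Finset.sum_eq_single i.succ]
      · simp only [h₁, neg_mul, Finset.sum_neg_distrib, neg_neg]
        simp [canonW, hPdef, krylov, pow_succ, Matrix.mul_apply]
      · intro b _ hb
        simp [canonW, hb]
      · simp
  set A := canonW N q * P with hA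
  have hAdet : A.det ≠ 0 := by
    rw [key, Matrix.det_neg, Matrix.det_mul, Matrix.det_mul, det_canonZ, hqN]
    exact mul_ne_zero (pow_ne_zero _ (neg_ne_zero.2 one_ne_zero))
      (mul_ne_zero (mul_ne_zero (neg_ne_zero.2 one_ne_zero) hPdet) hKdet)
  have hAu : IsUnit A.det := isUnit_iff_ne_zero.2 hAdet
  -- As `A = canonW · P`, the formula for `W` is immediate; `W = -K Z` and `key` turn `canonZ · P ·
  -- W` into `A Z`.
  refine ⟨A⁻¹, P * W, q, ?_, ?_, ?_, ?_⟩
  · exact (Matrix.isUnit_nonsing_inv_det A hAu).ne_zero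
  · rw [Matrix.det_mul]
    exact mul_ne_zero hPdet hW
  · rw [← Matrix.mul_assoc, Matrix.mul_assoc A⁻¹, ← hA, Matrix.nonsing_inv_mul _ hAu, one_mul]
  · have hWK : W = -(K * Z) := by rw [hKZ, neg_neg]
    have : A⁻¹ * canonZ N q * (P * W) = A⁻¹ * -(canonZ N q * P * K) * Z := by
      rw [hWK]
      simp only [Matrix.mul_neg, Matrix.neg_mul, Matrix.mul_assoc]
    rw [this, ← key, Matrix.nonsing_inv_mul _ hAu, one_mul]

end Reduction

/-! The space `𝒬_{n,v}(2)` and homogeneous polynomials in the `Q_a`. -/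

section SubstWZ

variable {n : ℕ} {R : Type} [CommRing R] [Algebra ℂ R]

lemma substWZ_matW (M N : Matrix (Fin n) (Fin n) R) : (matW n).map (substWZ M N) = M := by
  ext i j
  simp [matW, substWZ]

lemma substWZ_matZ (M N : Matrix (Fin n) (Fin n) R) : (matZ n).map (substWZ M N) = N := by
  ext i j
  simp [matZ, substWZ]

lemma eval_eq_substWZ (x : (Fin n × Fin n) ⊕ (Fin n × Fin n) → ℂ) (P : PolyWZ n) :
    MvPolynomial.eval x P = substWZ (Matrix.of fun s t => x (Sum.inl (s, t)))
      (Matrix.of fun s t => x (Sum.inr (s, t))) P := by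
  have h : x = Sum.elim (fun p => (Matrix.of fun s t => x (Sum.inl (s, t))) p.1 p.2)
      (fun p => (Matrix.of fun s t => x (Sum.inr (s, t))) p.1 p.2) := by
    funext p
    rcases p with p | p <;> rfl
  rw [substWZ, ← MvPolynomial.coe_aeval_eq_eval]
  exact congrArg (fun y => MvPolynomial.aeval y P) h

lemma substWZ_polyQ (M N : Matrix (Fin n) (Fin n) R) (a : ℕ) :
    substWZ M N (polyQ n a) = detCoeff M N a := by
  have h := detCoeff_map (substWZ M N : PolyWZ n →+* R) (matW n) (matZ n) a
  rw [polyQ_eq_detCoeff]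
  refine h.symm.trans ?_
  congr 1
  · exact substWZ_matW M N
  · exact substWZ_matZ M N

lemma substWZ_genAdj (M N : Matrix (Fin n) (Fin n) R) (a : ℕ) (i j : Fin n) :
    substWZ M N (genAdj n a i j) = adjCoeff M N a i j := by
  have h := adjCoeff_map (substWZ M N : PolyWZ n →+* R) (matW n) (matZ n) a
  have h' := congrFun (congrFun h i) j
  refine h'.symm.trans ?_
  congr 2
  · exact substWZ_matW M N
  · exact substWZ_matZ M N

lemma map_substWZ {S : Type} [CommRing S] [Algebra ℂ S] (φ : R →ₐ[ℂ] S)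
    (M N : Matrix (Fin n) (Fin n) R) (Q : PolyWZ n) :
    φ (substWZ M N Q) = substWZ (M.map φ) (N.map φ) Q := by
  have h : φ.comp (substWZ M N) = substWZ (M.map φ) (N.map φ) := by
    refine MvPolynomial.algHom_ext fun p => ?_
    rcases p with p | p <;> simp [substWZ]
  exact DFunLike.congr_fun h Q

lemma map_constMat (φ : PolyWZ n →ₐ[ℂ] R) (A : Matrix (Fin n) (Fin n) ℂ) :
    (constMat A).map φ = A.map (algebraMap ℂ R) := by
  ext i j
  simp [constMat]

/-- The defining identity is one of polynomials, so it may be specialised to matrices over any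
commutative `ℂ`-algebra, with `A` and `B` still complex. -/
lemma substWZ_of_mem_spaceQ {v : ℕ} {Q : PolyWZ n} (hQ : Q ∈ spaceQ n v)
    {A B : Matrix (Fin n) (Fin n) ℂ} (hA : A.det ≠ 0) (hB : B.det ≠ 0)
    (M N : Matrix (Fin n) (Fin n) R) :
    substWZ (A.map (algebraMap ℂ R) * M * B.map (algebraMap ℂ R))
        (A.map (algebraMap ℂ R) * N * B.map (algebraMap ℂ R)) Q =
      (A.det * B.det) ^ v • substWZ M N Q := by
  have h := hQ (Matrix.GeneralLinearGroup.mkOfDetNeZero A hA)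
    (Matrix.GeneralLinearGroup.mkOfDetNeZero Bᵀ (by rwa [Matrix.det_transpose]))
  have h' := congrArg (substWZ M N) h
  have hT : ((constMat Bᵀ)ᵀ : Matrix (Fin n) (Fin n) (PolyWZ n)) = constMat B := by
    ext i j
    simp [constMat]
  change substWZ M N (substWZ (constMat A * matW n * (constMat Bᵀ)ᵀ)
    (constMat A * matZ n * (constMat Bᵀ)ᵀ) Q) =
    substWZ M N ((A.det ^ v * Bᵀ.det ^ v) • Q) at h'
  have hm : ∀ X Y : Matrix (Fin n) (Fin n) (PolyWZ n), (X * Y).map (substWZ M N) =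
    X.map (substWZ M N) * Y.map (substWZ M N) := fun X Y => Matrix.map_mul
  rw [map_substWZ, hT, hm, hm, hm, hm, map_constMat, map_constMat, substWZ_matW, substWZ_matZ,
    map_smul, Matrix.det_transpose, ← mul_pow] at h'
  exact h'

end SubstWZ

section ToPoly

variable {n v : ℕ}

/-- The polynomial `∑_α C(α) ∏_j X_j^{α_j}`. -/
def toPoly (n v : ℕ) : (Index n v → ℂ) →ₗ[ℂ] MvPolynomial (Fin (n + 1)) ℂ where
  toFun C := ∑ α : Index n v,
    C α • MvPolynomial.monomial (Finsupp.equivFunOnFinite.symm α.1) (1 : ℂ)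
  map_add' C D := by simp only [Pi.add_apply, add_smul, Finset.sum_add_distrib]
  map_smul' c C := by
    simp only [Pi.smul_apply, smul_eq_mul, mul_smul, Finset.smul_sum, RingHom.id_apply]

lemma toPoly_apply (C : Index n v → ℂ) : toPoly n v C = ∑ α : Index n v,
    C α • MvPolynomial.monomial (Finsupp.equivFunOnFinite.symm α.1) (1 : ℂ) := rfl

lemma sum_index (α : Index n v) : ∑ j, α.1 j = v := (Finset.mem_piAntidiag.1 α.2).1

lemma mem_index {α : Fin (n + 1) → ℕ} (h : ∑ j, α j = v) :
    α ∈ Finset.piAntidiag Finset.univ v :=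
  Finset.mem_piAntidiag.2 ⟨h, fun _ _ => Finset.mem_univ _⟩

lemma coeff_toPoly (C : Index n v → ℂ) (α : Index n v) :
    MvPolynomial.coeff (Finsupp.equivFunOnFinite.symm α.1) (toPoly n v C) = C α := by
  rw [toPoly_apply, MvPolynomial.coeff_sum, Finset.sum_eq_single α]
  · simp
  · intro β _ hβ
    rw [MvPolynomial.coeff_smul, MvPolynomial.coeff_monomial, if_neg, smul_zero]
    intro h
    exact hβ (Subtype.ext (Finsupp.equivFunOnFinite.symm.injective h))
  · simp

lemma toPoly_injective : Function.Injective (toPoly n v) := fun C D h => by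
  ext α
  rw [← coeff_toPoly C, h, coeff_toPoly]

lemma isHomogeneous_toPoly (C : Index n v → ℂ) : (toPoly n v C).IsHomogeneous v := by
  rw [toPoly_apply]
  refine MvPolynomial.IsHomogeneous.sum _ _ _ fun α _ => ?_
  rw [MvPolynomial.smul_eq_C_mul]
  refine MvPolynomial.IsHomogeneous.C_mul (MvPolynomial.isHomogeneous_monomial _ ?_) _
  rw [Finsupp.degree_eq_sum]
  exact sum_index α

lemma exists_toPoly_eq {f : MvPolynomial (Fin (n + 1)) ℂ} (hf : f.IsHomogeneous v) :
    ∃ C : Index n v → ℂ, toPoly n v C = f := by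
  refine ⟨fun α => MvPolynomial.coeff (Finsupp.equivFunOnFinite.symm α.1) f, ?_⟩
  ext d
  by_cases hd : d.degree = v
  · have h : ∑ j, Finsupp.equivFunOnFinite d j = v := by
      rw [← hd, Finsupp.degree_eq_sum]
      rfl
    have h' := coeff_toPoly (fun α : Index n v =>
      MvPolynomial.coeff (Finsupp.equivFunOnFinite.symm α.1) f) ⟨_, mem_index h⟩
    simpa using h'
  · rw [hf.coeff_eq_zero hd, (isHomogeneous_toPoly _).coeff_eq_zero hd]

lemma ofCoeffs_eq_substQ (C : Index n v → ℂ) : ofCoeffs C = substQ n (toPoly n v C) := by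
  simp only [ofCoeffs, toPoly_apply, map_sum, map_smul]
  refine Finset.sum_congr rfl fun α _ => ?_
  rw [substQ, MvPolynomial.aeval_monomial, map_one, one_mul, Finsupp.prod_fintype]
  · rfl
  · simp

end ToPoly

lemma substWZ_substQ {n : ℕ} {R : Type} [CommRing R] [Algebra ℂ R]
    (M N : Matrix (Fin n) (Fin n) R) (f : MvPolynomial (Fin (n + 1)) ℂ) :
    substWZ M N (substQ n f) =
      MvPolynomial.aeval (fun a : Fin (n + 1) => detCoeff M N a) f := by
  have h : (substWZ M N).comp (substQ n) =
      MvPolynomial.aeval (fun a : Fin (n + 1) => detCoeff M N a) := by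
    refine MvPolynomial.algHom_ext fun a => ?_
    rw [AlgHom.comp_apply, substQ, MvPolynomial.aeval_X, MvPolynomial.aeval_X, substWZ_polyQ]
  exact DFunLike.congr_fun h f

/-- Every `Q_a` is multiplied by the same factor `det(A) det(B)`, so degree `v` gives its `v`-th
power. -/
lemma substQ_mem_spaceQ {n v : ℕ} {f : MvPolynomial (Fin (n + 1)) ℂ} (hf : f.IsHomogeneous v) :
    substQ n f ∈ spaceQ n v := by
  intro A B
  rw [substWZ_substQ]
  simp only [detCoeff_mul_mul]
  rw [aeval_const_mul_of_isHomogeneous hf, Algebra.smul_def]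
  have h : ∀ M : Matrix (Fin n) (Fin n) ℂ, (constMat M).det = algebraMap ℂ (PolyWZ n) M.det :=
    fun M => (RingHom.map_det (algebraMap ℂ (PolyWZ n)) M).symm
  rw [Matrix.det_transpose, h, h, ← mul_pow, map_pow, map_mul]
  rfl

/-! ### Restriction of invariant polynomials to the canonical pencils -/

section Section

variable {N : ℕ}

/-- The substitution of the canonical pencil with determinant `∑ X_a λ^a`. -/
def canonSubst (N : ℕ) : PolyWZ (N + 1) →ₐ[ℂ] MvPolynomial (Fin (N + 1 + 1)) ℂ :=
  substWZ (canonW N (varExt (N + 1))) (canonZ N (varExt (N + 1)))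

lemma canonSubst_substQ (f : MvPolynomial (Fin (N + 1 + 1)) ℂ) :
    canonSubst N (substQ (N + 1) f) = f := by
  rw [canonSubst, substWZ_substQ]
  have h : (fun a : Fin (N + 1 + 1) => detCoeff (canonW N (varExt (N + 1)))
      (canonZ N (varExt (N + 1))) a) = MvPolynomial.X := by
    funext a
    rw [detCoeff_canon, if_pos a.isLt, varExt, dif_pos a.isLt]
  rw [h, MvPolynomial.aeval_X_left_apply]

lemma genPoly_varExt_ne_zero : genPoly N (varExt (N + 1)) ≠ 0 := by
  intro h
  have h' := congrArg (fun p => p.coeff 0) h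
  simp only [coeff_genPoly, Polynomial.coeff_zero] at h'
  rw [if_pos (by omega), varExt, dif_pos (by omega)] at h'
  exact MvPolynomial.X_ne_zero _ h'

lemma canonSubst_genAdj (c : ℕ) (j : Fin (N + 1)) :
    canonSubst N (genAdj (N + 1) c j 0) = if c = j then 1 else 0 := by
  rw [canonSubst, substWZ_genAdj, adjCoeff_canon _ genPoly_varExt_ne_zero]

/-- The entry `(m, 0)` of `A_c` restricts to `δ_{c,m}`, which isolates one summand of
`radialPart_substQ`. -/
lemma canonSubst_radialPart (k₁ k₂ : ℕ) (m : Fin (N + 1))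
    (f : MvPolynomial (Fin (N + 1 + 1)) ℂ) :
    canonSubst N (radialPart k₁ k₂ 0 m (substQ (N + 1) f)) = coordOp k₁ k₂ m f := by
  rw [radialPart_substQ, map_sum, Finset.sum_eq_single (m : ℕ)]
  · rw [map_mul, canonSubst_genAdj, if_pos rfl, mul_one, canonSubst_substQ]
  · intro c _ hc
    rw [map_mul, canonSubst_genAdj, if_neg hc, mul_zero]
  · intro h
    exact absurd (Finset.mem_range.2 (by omega)) h

lemma isHomogeneous_canonSubst {v : ℕ} {Q : PolyWZ (N + 1)} (hQ : Q ∈ spaceQ (N + 1) v) :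
    (canonSubst N Q).IsHomogeneous v := by
  apply isHomogeneous_of_aeval_two_mul
  -- Left multiplication by `diag(2, 1, …, 1)` doubles the first row of the canonical pencil, hence
  -- all the variables `X_a` at once, and invariance turns this into a factor `2^v`.
  let A : Matrix (Fin (N + 1)) (Fin (N + 1)) ℂ :=
    Matrix.diagonal fun i => if i = 0 then 2 else 1
  have hA : A.det = 2 := by
    rw [Matrix.det_diagonal, Finset.prod_ite_eq' Finset.univ 0 fun _ => (2 : ℂ)]
    simp
  have h := substWZ_of_mem_spaceQ hQ (A := A) (B := 1) (by rw [hA]; exact two_ne_zero)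
    (by simp) (canonW N (varExt (N + 1))) (canonZ N (varExt (N + 1)))
  rw [hA, Matrix.det_one, mul_one] at h
  have hmap : A.map (algebraMap ℂ (MvPolynomial (Fin (N + 1 + 1)) ℂ)) =
      Matrix.diagonal fun i => if i = 0 then MvPolynomial.C 2 else 1 := by
    ext i j
    by_cases hij : i = j
    · subst hij
      by_cases hi : i = 0 <;> simp [A, hi, MvPolynomial.algebraMap_eq]
    · simp [A, hij]
  have hone : (1 : Matrix (Fin (N + 1)) (Fin (N + 1)) ℂ).map
      (algebraMap ℂ (MvPolynomial (Fin (N + 1 + 1)) ℂ)) = 1 :=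
    Matrix.map_one _ (map_zero _) (map_one _)
  rw [hmap, hone, mul_one, mul_one] at h
  rw [canonSubst, map_substWZ, ← MvPolynomial.smul_eq_C_mul, ← h]
  have hvar : ∀ e, MvPolynomial.aeval (R := ℂ) (fun i : Fin (N + 1 + 1) =>
      (MvPolynomial.C 2 * MvPolynomial.X i : MvPolynomial (Fin (N + 1 + 1)) ℂ))
        (varExt (N + 1) e) = MvPolynomial.C 2 * varExt (N + 1) e := by
    intro e
    unfold varExt
    split_ifs <;> simp
  congr 1
  congr 1
  · ext1 i j
    rw [Matrix.diagonal_mul]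
    by_cases hi : i = 0
    · simp only [canonW, Matrix.map_apply, Matrix.of_apply, hi, if_true]
      exact hvar _
    · simp only [canonW, Matrix.map_apply, Matrix.of_apply, hi, if_false, one_mul]
      split_ifs <;> simp
  · ext1 i j
    rw [Matrix.diagonal_mul]
    by_cases hi : i = 0
    · by_cases hj : (j : ℕ) = N
      · simp only [canonZ, Matrix.map_apply, Matrix.of_apply, hi, hj, if_true]
        exact hvar _
      · simp [canonZ, hi, hj]
    · simp only [canonZ, Matrix.map_apply, Matrix.of_apply, hi, if_false, one_mul]
      split_ifs <;> simp

lemma det_matW_ne_zero (n : ℕ) : (matW n).det ≠ 0 := by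
  intro h
  have h' : ((matW n).map (substWZ (1 : Matrix (Fin n) (Fin n) ℂ) 0)).det = 0 := by
    have := congrArg (substWZ (1 : Matrix (Fin n) (Fin n) ℂ) 0) h
    rw [AlgHom.map_det, map_zero] at this
    exact this
  rw [substWZ_matW, Matrix.det_one] at h'
  exact one_ne_zero h'

lemma det_matZ_ne_zero (n : ℕ) : (matZ n).det ≠ 0 := by
  intro h
  have h' : ((matZ n).map (substWZ (0 : Matrix (Fin n) (Fin n) ℂ) 1)).det = 0 := by
    have := congrArg (substWZ (0 : Matrix (Fin n) (Fin n) ℂ) 1) h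
    rw [AlgHom.map_det, map_zero] at this
    exact this
  rw [substWZ_matZ, Matrix.det_one] at h'
  exact one_ne_zero h'

lemma krylov_map {R S : Type*} [CommRing R] [CommRing S] (f : R →+* S)
    (K : Matrix (Fin (N + 1)) (Fin (N + 1)) R) : (krylov K).map f = krylov (K.map f) := by
  ext i j
  have h := congrFun (congrFun (map_pow f.mapMatrix K (i : ℕ)) 0) j
  simpa [krylov] using h

lemma substWZ_det_krylov (M Z : Matrix (Fin (N + 1)) (Fin (N + 1)) ℂ) :
    substWZ M Z (krylov (matW (N + 1) * (matZ (N + 1)).adjugate)).det =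
      (krylov (M * Z.adjugate)).det := by
  have h := RingHom.map_det (substWZ M Z : PolyWZ (N + 1) →+* ℂ)
    (krylov (matW (N + 1) * (matZ (N + 1)).adjugate))
  refine h.trans ?_
  rw [RingHom.mapMatrix_apply, krylov_map]
  have hadj : (matZ (N + 1)).adjugate.map (substWZ M Z : PolyWZ (N + 1) →+* ℂ) =
      ((matZ (N + 1)).map (substWZ M Z : PolyWZ (N + 1) →+* ℂ)).adjugate :=
    RingHom.map_adjugate _ _
  have h₁ : (matW (N + 1)).map (substWZ M Z : PolyWZ (N + 1) →+* ℂ) = M := substWZ_matW M Z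
  have h₂ : (matZ (N + 1)).map (substWZ M Z : PolyWZ (N + 1) →+* ℂ) = Z := substWZ_matZ M Z
  rw [Matrix.map_mul, hadj, h₁, h₂]

lemma det_krylov_ne_zero :
    (krylov (matW (N + 1) * (matZ (N + 1)).adjugate)).det ≠ 0 := by
  intro h
  -- For the nilpotent shift `e_0 S^i = e_i`, so its Krylov matrix is the identity.
  let S : Matrix (Fin (N + 1)) (Fin (N + 1)) ℂ :=
    Matrix.of fun i j => if (j : ℕ) = i + 1 then 1 else 0
  have h' := congrArg (substWZ S 1) h
  rw [substWZ_det_krylov, map_zero, Matrix.adjugate_one, mul_one] at h'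
  have hS : ∀ i < N + 1, ∀ j : Fin (N + 1), (S ^ i) 0 j = if (j : ℕ) = i then 1 else 0 := by
    intro i
    induction i with
    | zero =>
      intro _ j
      rw [pow_zero, Matrix.one_apply]
      exact if_congr (by rw [Fin.ext_iff]; exact eq_comm) rfl rfl
    | succ i ih =>
      intro hi j
      rw [pow_succ, Matrix.mul_apply, Finset.sum_eq_single ⟨i, by omega⟩]
      · rw [ih (by omega)]
        simp [S]
      · intro b _ hb
        have : (b : ℕ) ≠ i := fun e => hb (Fin.ext e)
        rw [ih (by omega), if_neg this, zero_mul]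
      · simp
  have h₁ : krylov S = 1 := by
    ext i j
    rw [krylov, Matrix.of_apply, hS i i.isLt, Matrix.one_apply]
    exact if_congr (by rw [Fin.ext_iff]; exact eq_comm) rfl rfl
  rw [h₁, Matrix.det_one] at h'
  exact one_ne_zero h'

/-- Where the normal form exists, both sides scale by the same power of `det(A) det(B)` and agree on
the canonical pencil; a polynomial identity on a nonempty Zariski-open set holds everywhere. -/
lemma substQ_canonSubst {v : ℕ} {Q : PolyWZ (N + 1)} (hQ : Q ∈ spaceQ (N + 1) v) :
    substQ (N + 1) (canonSubst N Q) = Q := by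
  -- The product is nonzero exactly where `exists_canon_eq` applies. Multiplying by it makes the
  -- identity trivial at all other points, and it can be cancelled.
  have hprod : (matW (N + 1)).det * (matZ (N + 1)).det *
      (krylov (matW (N + 1) * (matZ (N + 1)).adjugate)).det ≠ 0 :=
    mul_ne_zero (mul_ne_zero (det_matW_ne_zero _) (det_matZ_ne_zero _)) det_krylov_ne_zero
  rw [← sub_eq_zero]
  refine (mul_eq_zero.1 ?_).resolve_left hprod
  refine MvPolynomial.funext fun x => ?_
  let W : Matrix (Fin (N + 1)) (Fin (N + 1)) ℂ := Matrix.of fun s t => x (Sum.inl (s, t))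
  let Z : Matrix (Fin (N + 1)) (Fin (N + 1)) ℂ := Matrix.of fun s t => x (Sum.inr (s, t))
  have hx : ∀ P : PolyWZ (N + 1), MvPolynomial.eval x P = substWZ W Z P :=
    eval_eq_substWZ x
  have hdet : ∀ M : Matrix (Fin (N + 1)) (Fin (N + 1)) (PolyWZ (N + 1)),
      substWZ W Z M.det = (M.map (substWZ W Z)).det := fun M => AlgHom.map_det _ _
  rw [hx, map_mul, map_mul, map_mul, hdet, hdet, substWZ_matW, substWZ_matZ,
    substWZ_det_krylov, map_zero]
  by_cases hW : W.det = 0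
  · simp [hW]
  by_cases hZ : Z.det = 0
  · simp [hZ]
  by_cases hP : (krylov (W * Z.adjugate)).det = 0
  · simp [hP]
  obtain ⟨A, B, q, hA, hB, hWq, hZq⟩ := exists_canon_eq W Z hW hZ hP
  refine mul_eq_zero_of_right _ ?_
  rw [map_sub, sub_eq_zero, substWZ_substQ]
  have h₁ := substWZ_of_mem_spaceQ hQ hA hB (canonW N q) (canonZ N q)
  rw [Algebra.algebraMap_self, RingHom.coe_id, Matrix.map_id, Matrix.map_id, ← hWq, ← hZq] at h₁
  rw [h₁]
  have h₂ : (fun a : Fin (N + 1 + 1) => detCoeff W Z a) =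
      fun a : Fin (N + 1 + 1) => A.det * B.det * q a := by
    funext a
    rw [hWq, hZq, detCoeff_mul_mul, detCoeff_canon, if_pos a.isLt]
  rw [h₂, aeval_const_mul_of_isHomogeneous (isHomogeneous_canonSubst hQ), smul_eq_mul]
  congr 1
  rw [canonSubst, map_substWZ]
  have hvar : ∀ e < N + 2, MvPolynomial.aeval (R := ℂ) (fun a : Fin (N + 1 + 1) => q a)
      (varExt (N + 1) e) = q e := by
    intro e he
    rw [varExt, dif_pos he, MvPolynomial.aeval_X]
  congr 1
  congr 1
  · ext1 i j
    by_cases hi : i = 0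
    · simp only [canonW, Matrix.map_apply, Matrix.of_apply, hi, if_true]
      exact hvar j (by omega)
    · simp only [canonW, Matrix.map_apply, Matrix.of_apply, hi, if_false]
      split_ifs <;> simp
  · ext1 i j
    by_cases hi : i = 0
    · by_cases hj : (j : ℕ) = N
      · simp only [canonZ, Matrix.map_apply, Matrix.of_apply, hi, hj, if_true]
        exact hvar (N + 1) (by omega)
      · simp [canonZ, hi, hj]
    · simp only [canonZ, Matrix.map_apply, Matrix.of_apply, hi, if_false]
      split_ifs <;> simp

lemma ofCoeffs_injective {v : ℕ} :
    Function.Injective (ofCoeffs : (Index (N + 1) v → ℂ) → PolyWZ (N + 1)) := by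
  intro C D h
  rw [ofCoeffs_eq_substQ, ofCoeffs_eq_substQ] at h
  have h' := congrArg (canonSubst N) h
  rw [canonSubst_substQ, canonSubst_substQ] at h'
  exact toPoly_injective h'

lemma existsUnique_ofCoeffs {v : ℕ} {Q : PolyWZ (N + 1)} (hQ : Q ∈ spaceQ (N + 1) v) :
    ∃! C : Index (N + 1) v → ℂ, Q = ofCoeffs C := by
  obtain ⟨C, hC⟩ := exists_toPoly_eq (isHomogeneous_canonSubst hQ)
  have h : Q = ofCoeffs C := by rw [ofCoeffs_eq_substQ, hC, substQ_canonSubst hQ]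
  exact ⟨C, h, fun D hD => ofCoeffs_injective (hD.symm.trans h)⟩

lemma ofCoeffs_mem_spaceQ {n v : ℕ} (C : Index n v → ℂ) : ofCoeffs C ∈ spaceQ n v := by
  rw [ofCoeffs_eq_substQ]
  exact substQ_mem_spaceQ (isHomogeneous_toPoly C)

end Section

/-! The linear relations as coefficients. -/

section Relations

open MvPolynomial

variable {n v : ℕ}

lemma coeffExt_natCast (C : Index n v → ℂ) (e : Fin (n + 1) →₀ ℕ) :
    coeffExt C (fun j => (e j : ℤ)) = coeff e (toPoly n v C) := by
  rw [coeffExt, toPoly_apply, coeff_sum]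
  refine Finset.sum_congr rfl fun α _ => ?_
  rw [coeff_smul, coeff_monomial, smul_eq_mul, mul_ite, mul_one, mul_zero]
  refine if_congr ?_ rfl rfl
  rw [Finsupp.ext_iff]
  simp

lemma coeffExt_eq_zero_of_neg (C : Index n v → ℂ) {β : Fin (n + 1) → ℤ} {j : Fin (n + 1)}
    (h : β j < 0) : coeffExt C β = 0 := by
  refine Finset.sum_eq_zero fun α _ => if_neg fun hα => ?_
  have := hα j
  omega

lemma unitTuple_apply (j i : Fin (n + 1)) : unitTuple n j i = if i = j then 1 else 0 := by
  simp [unitTuple, Fin.ext_iff]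

/-- For `d_e > 0`, `γ` is the exponent that two derivatives and the factor `X_e` send to `d`. If
`d_e = 0` the left side vanishes; so does the right, since either `γ` has a negative entry or the
integer factor is zero. -/
lemma coeff_varExt_mul (C : Index n v → ℂ) (d : Fin (n + 1) →₀ ℕ) (e : ℕ)
    (a b : Fin (n + 1)) (γ : Fin (n + 1) → ℤ)
    (hγ : γ = (fun j => (d j : ℤ)) + unitTuple n a + unitTuple n b - unitTuple n e) :
    coeff d (varExt n e * pderiv b (pderiv a (toPoly n v C))) =
      if e ≤ n then coeffExt C γ * ((γ a * (γ b - if a = b then 1 else 0) : ℤ) : ℂ) else 0 := by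
  unfold varExt
  by_cases he : e ≤ n
  swap
  · rw [dif_neg (by omega), if_neg he, zero_mul, coeff_zero]
  rw [dif_pos (by omega), if_pos he, coeff_X_mul']
  obtain ⟨e, rfl⟩ : ∃ e' : Fin (n + 1), (e' : ℕ) = e := ⟨⟨e, by omega⟩, rfl⟩
  simp only [Fin.eta]
  have hγ' : ∀ j, γ j = d j + (if j = a then 1 else 0) + (if j = b then 1 else 0) -
      (if j = e then 1 else 0) := by
    intro j
    rw [hγ]
    simp [unitTuple_apply]
  by_cases hd : d e = 0
  · rw [if_neg (by simpa using hd)]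
    by_cases hab : e ≠ a ∧ e ≠ b
    · rw [coeffExt_eq_zero_of_neg C (j := e), zero_mul]
      rw [hγ', hd]
      simp [hab]
    · have hz : γ a * (γ b - if a = b then 1 else 0) = 0 := by
        rw [not_and_or, not_not, not_not] at hab
        rcases hab with rfl | rfl
        · by_cases hb : e = b
          · subst hb
            simp [hγ', hd]
          · simp [hγ', hd, hb]
        · by_cases ha : a = e
          · subst ha
            simp [hγ', hd]
          · simp [hγ', hd, ha, Ne.symm ha]
      rw [hz, Int.cast_zero, mul_zero]
  · rw [if_pos (by simpa using hd), coeff_pderiv, coeff_pderiv, ← coeffExt_natCast]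
    have hle : Finsupp.single e 1 ≤ d := Finsupp.single_le_iff.2 (Nat.one_le_iff_ne_zero.2 hd)
    have hsub : ∀ j, (((d - Finsupp.single e 1 : Fin (n + 1) →₀ ℕ) j : ℕ) : ℤ) = d j - (if j = e then 1 else 0) := by
      intro j
      rw [Finsupp.tsub_apply, Nat.cast_sub (hle j), Finsupp.single_apply]
      simp [eq_comm]
    have h₁ : (fun j => (((d - Finsupp.single e 1 + Finsupp.single b 1 +
        Finsupp.single a 1 : Fin (n + 1) →₀ ℕ) j : ℕ) : ℤ)) = γ := by
      funext j
      rw [hγ', Finsupp.add_apply, Finsupp.add_apply, Nat.cast_add, Nat.cast_add, hsub]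
      simp only [Finsupp.single_apply, eq_comm (b := j), Nat.cast_ite, Nat.cast_one,
        Nat.cast_zero]
      ring
    rw [h₁]
    have h₂ : γ a =
        ((d - Finsupp.single e 1 + Finsupp.single b 1 : Fin (n + 1) →₀ ℕ) a : ℕ) + 1 := by
      rw [← h₁]
      simp
    have h₃ : γ b - (if a = b then 1 else 0) =
        ((d - Finsupp.single e 1 : Fin (n + 1) →₀ ℕ) b : ℕ) + 1 := by
      rw [← h₁]
      simp [Finsupp.single_apply]
    rw [h₂, h₃]
    push_cast
    ring

/-- Off-diagonal pairs are counted twice, which is the origin of the factor `2 - δ` in the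
relations. -/
lemma sum_sum_eq_of_symm {ι M : Type*} [Fintype ι] [LinearOrder ι] [CommRing M]
    (f : ι → ι → M) (hf : ∀ a b, f a b = f b a) :
    ∑ a, ∑ b, f a b = ∑ a, ∑ b, if a ≤ b then f a b * (2 - if a = b then 1 else 0) else 0 := by
  have h : ∀ a b, f a b = (if a ≤ b then f a b * (if a = b then 1 else 1) else 0) +
      (if b ≤ a then f b a * (if b = a then 0 else 1) else 0) := by
    intro a b
    rcases lt_trichotomy a b with h | h | h
    · simp [h.le, h.not_ge]
    · simp [h]
    · simp [h.le, h.not_ge, h.ne, hf a b]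
  calc ∑ a, ∑ b, f a b
      = ∑ a, ∑ b, (if a ≤ b then f a b * (if a = b then 1 else 1) else 0) +
        ∑ a, ∑ b, (if b ≤ a then f b a * (if b = a then 0 else 1) else 0) := by
        rw [← Finset.sum_add_distrib]
        refine Finset.sum_congr rfl fun a _ => ?_
        rw [← Finset.sum_add_distrib]
        exact Finset.sum_congr rfl fun b _ => h a b
    _ = _ := by
        rw [Finset.sum_comm (f := fun a b => if b ≤ a then f b a * (if b = a then 0 else 1) else 0),
          ← Finset.sum_add_distrib]
        refine Finset.sum_congr rfl fun a _ => ?_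
        rw [← Finset.sum_add_distrib]
        refine Finset.sum_congr rfl fun b _ => ?_
        split_ifs <;> ring

/-- The minimality of `m` removes the terms with lower indices: the exponent `d = α - 1_m` has no
entries before `m`. -/
lemma coeff_coordOp (k₁ k₂ : ℕ) (C : Index n v → ℂ) (α : Index n v) (m : Fin n)
    (hm : 0 < α.1 m.castSucc) (hα : ∀ j : Fin (n + 1), j < m.castSucc → α.1 j = 0) :
    coeff (Finsupp.equivFunOnFinite.symm α.1 - Finsupp.single m.castSucc 1)
      (coordOp k₁ k₂ m (toPoly n v C)) = relationExpr k₁ k₂ C (fun j => (α.1 j : ℤ)) m := by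
  set α' : Fin (n + 1) → ℤ := fun j => (α.1 j : ℤ) with hα'
  set d := Finsupp.equivFunOnFinite.symm α.1 - Finsupp.single m.castSucc 1 with hd
  have hle : Finsupp.single m.castSucc 1 ≤ Finsupp.equivFunOnFinite.symm α.1 :=
    Finsupp.single_le_iff.2 hm
  have hdα : d + Finsupp.single m.castSucc 1 = Finsupp.equivFunOnFinite.symm α.1 :=
    tsub_add_cancel_of_le hle
  have hdint : (fun j => (d j : ℤ)) = α' - unitTuple n m := by
    funext j
    have h := DFunLike.congr_fun hdα j
    rw [Finsupp.add_apply, Finsupp.single_apply] at h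
    have h' : unitTuple n m j = if m.castSucc = j then 1 else 0 := by
      simp [unitTuple, Fin.ext_iff, eq_comm]
    rw [Pi.sub_apply, h', hα']
    have h'' : Finsupp.equivFunOnFinite.symm α.1 j = α.1 j := rfl
    rw [h''] at h
    simp only
    rw [← h]
    push_cast
    ring
  have hdlt : ∀ j : Fin (n + 1), j < m.castSucc → d j = 0 := by
    intro j hj
    have h := DFunLike.congr_fun hdα j
    have h'' : Finsupp.equivFunOnFinite.symm α.1 j = α.1 j := rfl
    rw [Finsupp.add_apply, h'', hα j hj] at h
    omega
  -- the terms of second order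
  set T : ℕ → Fin (n + 1) → Fin (n + 1) → ℂ := fun e a b =>
    coeff d (varExt n e * pderiv b (pderiv a (toPoly n v C))) with hT
  have hTsymm : ∀ e a b, T e a b = T e b a := fun e a b => by
    simp only [hT]
    rw [pderiv_pderiv_comm]
  have hTm : T m m.castSucc m.castSucc =
      coeffExt C α' * ((α' m.castSucc * (α' m.castSucc - 1) : ℤ) : ℂ) := by
    simp only [hT]
    rw [coeff_varExt_mul C d m _ _ α', if_pos m.isLt.le, if_pos rfl]
    rw [hdint]
    simp
  -- The polynomial is divisible by `X_e`, whereas `d_e = 0` for `e < m`.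
  have hTzero : ∀ (e : ℕ) (a b : Fin (n + 1)), e < m → e ≤ a → e ≤ b → (e = a → e ≠ b) →
      T e a b = 0 := by
    intro e a b hem hea heb hab
    obtain ⟨e, rfl⟩ : ∃ e' : Fin (n + 1), (e' : ℕ) = e := ⟨⟨e, by omega⟩, rfl⟩
    have hde : d e = 0 := hdlt _ (by simpa [Fin.lt_def] using hem)
    simp only [hT]
    rw [coeff_varExt_mul C d e a b _ rfl, if_pos (by omega)]
    by_cases h₁ : e = a
    · subst h₁
      have h₂ : e ≠ b := fun h => hab rfl (by rw [h])
      simp [unitTuple_apply, hde, h₂]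
    · by_cases h₂ : e = b
      · subst h₂
        simp [unitTuple_apply, hde, h₁, Ne.symm h₁]
      · rw [coeffExt_eq_zero_of_neg C (j := e), zero_mul]
        simp [unitTuple_apply, hde, h₁, h₂]
  -- The sign is `1` if `a, b ≤ m`, `-1` if `a, b > m`, and `0` otherwise. In the first case only `a
  -- = b = m` survives, by `hTzero`.
  have hterm : ∀ a b : Fin (n + 1), (pencilSign b a m : ℂ) *
      ((if (m : ℕ) < (b : ℕ) + a + 1 then T (b + a - m) a b else 0) -
        (if (m : ℕ) < (b : ℕ) + a then T (b + a - 1 - m) a b else 0)) =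
      (if a = m.castSucc then if b = m.castSucc then T m m.castSucc m.castSucc else 0 else 0) +
        ((if (m : ℕ) < a ∧ (m : ℕ) < b then T (a + b - m - 1) a b else 0) -
          if (m : ℕ) < a ∧ (m : ℕ) < b then T (a + b - m) a b else 0) := by
    intro a b
    by_cases h₁ : (a : ℕ) ≤ m ∧ (b : ℕ) ≤ m
    · obtain ⟨ha, hb⟩ := h₁
      have hs : pencilSign b a m = 1 := by
        unfold pencilSign
        rw [if_pos (by omega), if_neg (by omega), sub_zero]
      rw [hs, if_neg (show ¬((m : ℕ) < a ∧ (m : ℕ) < b) by omega),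
        if_neg (show ¬((m : ℕ) < a ∧ (m : ℕ) < b) by omega)]
      have h₂ : (if (m : ℕ) < (b : ℕ) + a then T (b + a - 1 - m) a b else 0) = 0 := by
        split_ifs
        · exact hTzero _ _ _ (by omega) (by omega) (by omega) (by omega)
        · rfl
      rw [h₂]
      by_cases h₃ : a = m.castSucc
      · by_cases h₄ : b = m.castSucc
        · subst h₃ h₄
          simp
        · have h₅ : (b : ℕ) ≠ m := fun h => h₄ (Fin.ext h)
          have h₆ : (a : ℕ) = m := by rw [h₃]; rfl
          rw [hTzero _ _ _ (by omega) (by omega) (by omega) (by omega)]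
          simp [h₄]
      · have h₅ : (a : ℕ) ≠ m := fun h => h₃ (Fin.ext h)
        rw [if_neg h₃]
        split_ifs
        · rw [hTzero _ _ _ (by omega) (by omega) (by omega) (by omega)]
          simp
        · simp
    · have h₂ : ¬(a = m.castSucc ∧ b = m.castSucc) := by
        rintro ⟨rfl, rfl⟩
        simp at h₁
      rw [← ite_and, if_neg h₂, zero_add]
      by_cases h₃ : (m : ℕ) < a ∧ (m : ℕ) < b
      · have hs : pencilSign b a m = -1 := by
          unfold pencilSign
          rw [if_neg (by omega), if_pos (by omega), zero_sub]
        rw [hs, if_pos h₃, if_pos h₃, if_pos (by omega), if_pos (by omega),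
          show (b : ℕ) + a - m = a + b - m by omega,
          show (b : ℕ) + a - 1 - m = a + b - m - 1 by omega]
        push_cast
        ring
      · have hs : pencilSign b a m = 0 := by
          unfold pencilSign
          rw [if_neg (by omega), if_neg (by omega), sub_zero]
        rw [hs, if_neg h₃, if_neg h₃]
        simp
  have hshift : ∀ (a b : Fin (n + 1)) (e : ℕ),
      T e a b * (2 - if a = b then 1 else 0) = if e ≤ n then
        coeffExt C (α' - unitTuple n m + unitTuple n a + unitTuple n b - unitTuple n e) *
          ((pairFactor (α' - unitTuple n m + unitTuple n a + unitTuple n b - unitTuple n e)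
            a b : ℤ) : ℂ) else 0 := by
    intro a b e
    simp only [hT]
    rw [coeff_varExt_mul C d e a b _ (by rw [hdint])]
    split_ifs with he hab
    · simp only [pairFactor, hab, if_true]
      push_cast
      ring
    · simp only [pairFactor, hab, if_false]
      push_cast
      ring
    · simp
    · simp
  have hfirst : ∀ (κ : ℂ) (a : Fin (n + 1)) (e : ℕ), (a : ℕ) = e →
      coeff d (MvPolynomial.C κ * pderiv a (toPoly n v C)) =
        κ * (coeffExt C (α' - unitTuple n m + unitTuple n e) *
          (((α' - unitTuple n m + unitTuple n e) a : ℤ) : ℂ)) := by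
    intro κ a e hae
    subst hae
    have h₁ : (fun j => (((d + Finsupp.single a 1 : Fin (n + 1) →₀ ℕ) j : ℕ) : ℤ)) =
        α' - unitTuple n m + unitTuple n a := by
      rw [← hdint]
      funext j
      simp [unitTuple_apply, Finsupp.single_apply, eq_comm]
    rw [coeff_C_mul, coeff_pderiv, ← coeffExt_natCast, h₁, ← h₁]
    simp
  have hsum₁ : ∀ (κ : MvPolynomial (Fin (n + 1)) ℂ) (κ' : ℂ) (a₀ : Fin (n + 1)) (e : ℕ),
      κ = MvPolynomial.C κ' → (a₀ : ℕ) = e →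
      ∑ a : Fin (n + 1), coeff d ((if (a : ℕ) = e then κ else 0) * pderiv a (toPoly n v C)) =
        κ' * (coeffExt C (α' - unitTuple n m + unitTuple n e) *
          (((α' - unitTuple n m + unitTuple n e) a₀ : ℤ) : ℂ)) := by
    intro κ κ' a₀ e hκ ha₀
    rw [Finset.sum_eq_single a₀]
    · rw [if_pos ha₀, hκ, hfirst _ _ _ ha₀]
    · intro b _ hb
      have : (b : ℕ) ≠ e := fun h => hb (Fin.ext (h.trans ha₀.symm))
      rw [if_neg this, zero_mul, coeff_zero]
    · simp
  have hsecond : ∀ a b : Fin (n + 1),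
      coeff d ((pencilSign b a m : MvPolynomial (Fin (n + 1)) ℂ) *
        ((if (m : ℕ) < (b : ℕ) + a + 1 then varExt n (b + a - m) else 0) -
          (if (m : ℕ) < (b : ℕ) + a then varExt n (b + a - 1 - m) else 0)) *
        pderiv b (pderiv a (toPoly n v C))) =
      (pencilSign b a m : ℂ) *
      ((if (m : ℕ) < (b : ℕ) + a + 1 then T (b + a - m) a b else 0) -
        (if (m : ℕ) < (b : ℕ) + a then T (b + a - 1 - m) a b else 0)) := by
    intro a b
    have h : ((pencilSign b a m : ℤ) : MvPolynomial (Fin (n + 1)) ℂ) =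
        MvPolynomial.C ((pencilSign b a m : ℤ) : ℂ) := by simp
    rw [h, mul_assoc, coeff_C_mul, sub_mul, coeff_sub]
    simp only [ite_mul, zero_mul, apply_ite (coeff d), coeff_zero, hT]
  rw [coordOp, coeff_add, coeff_add, coeff_sum, coeff_sum, coeff_sum,
    hsum₁ _ ((k₁ : ℂ) + 1 - n + (m : ℕ)) m.castSucc m (by simp) rfl,
    hsum₁ _ ((k₂ : ℂ) - (m : ℕ)) m.succ _ (by simp) (by simp)]
  simp only [coeff_sum, hsecond, hterm, Finset.sum_add_distrib, Finset.sum_sub_distrib]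
  rw [sum_sum_eq_of_symm (fun a b : Fin (n + 1) => if (m : ℕ) < a ∧ (m : ℕ) < b then
      T (a + b - m - 1) a b else 0) (fun a b => by
        simp only [and_comm (a := (m : ℕ) < a), add_comm (a : ℕ), hTsymm _ a b]),
    sum_sum_eq_of_symm (fun a b : Fin (n + 1) => if (m : ℕ) < a ∧ (m : ℕ) < b then
      T (a + b - m) a b else 0) (fun a b => by
        simp only [and_comm (a := (m : ℕ) < a), add_comm (a : ℕ), hTsymm _ a b])]
  have hpair : ∀ (e : Fin (n + 1) → Fin (n + 1) → ℕ),
      ∑ a : Fin (n + 1), ∑ b : Fin (n + 1), (if a ≤ b then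
        (if (m : ℕ) < a ∧ (m : ℕ) < b then T (e a b) a b else 0) *
          (2 - if a = b then 1 else 0) else 0) =
      ∑ l : Fin (n + 1), ∑ l' : Fin (n + 1),
        (if (m : ℕ) < l ∧ l ≤ l' ∧ e l l' ≤ n then
          coeffExt C (α' - unitTuple n m + unitTuple n l + unitTuple n l' -
            unitTuple n (e l l')) *
          ((pairFactor (α' - unitTuple n m + unitTuple n l + unitTuple n l' -
            unitTuple n (e l l')) l l' : ℤ) : ℂ) else 0) := by
    intro e
    refine Finset.sum_congr rfl fun a _ => Finset.sum_congr rfl fun b _ => ?_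
    by_cases hab : a ≤ b
    · by_cases hma : (m : ℕ) < a
      · have hmb : (m : ℕ) < b := hma.trans_le hab
        rw [if_pos hab, if_pos ⟨hma, hmb⟩, hshift]
        simp [hab, hma]
      · rw [if_pos hab]
        simp [hma]
    · rw [if_neg hab, if_neg (fun h => hab h.2.1)]
  rw [hpair, hpair]
  have hdiag : ∑ a : Fin (n + 1), ∑ b : Fin (n + 1), (if a = m.castSucc then
      if b = m.castSucc then T m m.castSucc m.castSucc else 0 else 0) =
      T m m.castSucc m.castSucc := by
    simp
  rw [hdiag, hTm, relationExpr]
  simp only [shift, shiftTilde, sub_add_cancel]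
  push_cast
  ring

end Relations

/-! The relations determine the coefficients. -/

section Uniqueness

variable {n v : ℕ}

lemma coeffExt_natCast_index (C : Index n v → ℂ) (α : Index n v) :
    coeffExt C (fun j => (α.1 j : ℤ)) = C α :=
  (coeffExt_natCast C (Finsupp.equivFunOnFinite.symm α.1)).trans (coeff_toPoly C α)

lemma eq_lastIndex {α : Index n v} (h : ∀ m : Fin n, α.1 m.castSucc = 0) :
    α = lastIndex n v := by
  have hsum := sum_index α
  rw [Fin.sum_univ_castSucc, Finset.sum_eq_zero fun i _ => h i, zero_add] at hsum
  refine Subtype.ext (funext fun j => ?_)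
  refine Fin.lastCases ?_ (fun i => ?_) j
  · simp [lastIndex, hsum]
  · simp [lastIndex, h i, (Fin.castSucc_lt_last i).ne]

lemma exists_least_pos {α : Index n v} (h : α ≠ lastIndex n v) :
    ∃ m : Fin n, 0 < α.1 m.castSucc ∧ ∀ j : Fin (n + 1), j < m.castSucc → α.1 j = 0 := by
  have h₁ : ∃ m : Fin n, 0 < α.1 m.castSucc := by
    by_contra! h'
    exact h (eq_lastIndex fun m => Nat.le_zero.1 (h' m))
  classical
  obtain ⟨m, hm, hmin⟩ := WellFounded.has_min (wellFounded_lt (α := Fin n))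
    {m | 0 < α.1 m.castSucc} h₁
  refine ⟨m, hm, fun j hj => ?_⟩
  by_contra hne
  have hjn : (j : ℕ) < n := by
    have h₂ : (j : ℕ) < m := hj
    omega
  exact hmin ⟨j, hjn⟩ (Nat.pos_of_ne_zero hne) hj

/-- Lexicographic induction: every tuple in the relation other than `α` vanishes before `m` and has
`m`-th entry `α_m - 1`, so its coefficient is already known to be zero. -/
lemma eq_zero_of_satisfiesRelations {k₁ k₂ : ℕ} (hk₁ : n ≤ k₁) {C : Index n v → ℂ}
    (hC : SatisfiesRelations k₁ k₂ C) (h₀ : C (lastIndex n v) = 0) : C = 0 := by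
  have hwf : WellFounded fun α β : Index n v => toLex α.1 < toLex β.1 :=
    InvImage.wf (fun α : Index n v => toLex α.1) wellFounded_lt
  funext α
  induction α using hwf.induction with
  | _ α ih =>
  by_cases hα : α = lastIndex n v
  · rw [hα, h₀]
    rfl
  obtain ⟨m, hm, hmin⟩ := exists_least_pos hα
  have hsmall : ∀ β : Fin (n + 1) → ℤ, (∀ j < m.castSucc, β j = 0) →
      β m.castSucc = α.1 m.castSucc - 1 → coeffExt C β = 0 := by
    intro β hβ hβm
    refine Finset.sum_eq_zero fun γ _ => ?_
    split_ifs with hγ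
    · refine ih γ ⟨m.castSucc, fun j hj => ?_, ?_⟩
      · have h₁ := hγ j
        rw [hβ j hj] at h₁
        have h₂ := hmin j hj
        change γ.1 j = α.1 j
        omega
      · have h₁ := hγ m.castSucc
        change γ.1 m.castSucc < α.1 m.castSucc
        omega
    · rfl
  have hunit_lt : ∀ (l : ℕ) (j : Fin (n + 1)), (j : ℕ) < l → unitTuple n l j = 0 :=
    fun l j h => if_neg h.ne
  have hunit_m : unitTuple n m m.castSucc = 1 := if_pos rfl
  have hrel := hC α hα m hm hmin
  have hsingle : coeffExt C ((fun j => (α.1 j : ℤ)) - unitTuple n m +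
      unitTuple n ((m : ℕ) + 1)) = 0 := by
    refine hsmall _ (fun j hj => ?_) ?_
    · have hj' : (j : ℕ) < m := hj
      simp [hunit_lt _ j hj', hunit_lt _ j (Nat.lt_succ_of_lt hj'), hmin j hj]
    · simp [hunit_m, hunit_lt ((m : ℕ) + 1) m.castSucc (by simp)]
  -- Both `ℓ + ℓ' - m` and `ℓ + ℓ' - m - 1` exceed `m` because `ℓ, ℓ' > m`, so no subtracted unit
  -- tuple affects the entries up to `m` beyond `1_m`.
  have hpair : ∀ l l' e : ℕ, (m : ℕ) < l → (m : ℕ) < l' → (m : ℕ) < e →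
      coeffExt C ((fun j => (α.1 j : ℤ)) - unitTuple n m + unitTuple n l + unitTuple n l' -
        unitTuple n e) = 0 := by
    intro l l' e hl hl' he
    refine hsmall _ (fun j hj => ?_) ?_
    · have hj' : (j : ℕ) < m := hj
      simp [hunit_lt _ j hj', hunit_lt _ j (hj'.trans hl), hunit_lt _ j (hj'.trans hl'),
        hunit_lt _ j (hj'.trans he), hmin j hj]
    · simp [hunit_m, hunit_lt _ m.castSucc hl, hunit_lt _ m.castSucc hl',
        hunit_lt _ m.castSucc he]
  have hs₁ : ∀ l l' : Fin (n + 1), (if (m : ℕ) < l ∧ l ≤ l' ∧ (l : ℕ) + l' - m - 1 ≤ n then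
      coeffExt C (shiftTilde (fun j => (α.1 j : ℤ)) m l l') *
        ((pairFactor (shiftTilde (fun j => (α.1 j : ℤ)) m l l') l l' : ℤ) : ℂ) else 0) = 0 := by
    intro l l'
    split_ifs with h
    · have h₁ : (l : ℕ) ≤ l' := h.2.1
      rw [shiftTilde, hpair _ _ _ h.1 (h.1.trans_le h₁) (by omega), zero_mul]
    · rfl
  have hs₂ : ∀ l l' : Fin (n + 1), (if (m : ℕ) < l ∧ l ≤ l' ∧ (l : ℕ) + l' - m ≤ n then
      coeffExt C (shift (fun j => (α.1 j : ℤ)) m l l') *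
        ((pairFactor (shift (fun j => (α.1 j : ℤ)) m l l') l l' : ℤ) : ℂ) else 0) = 0 := by
    intro l l'
    split_ifs with h
    · have h₁ : (l : ℕ) ≤ l' := h.2.1
      rw [shift, hpair _ _ _ h.1 (h.1.trans_le h₁) (by omega), zero_mul]
    · rfl
  rw [relationExpr, hsingle, coeffExt_natCast_index] at hrel
  simp only [hs₁, hs₂, Finset.sum_const_zero, zero_mul, add_zero, sub_zero] at hrel
  -- The remaining factor of `C(α)` is `α_m (k₁ - n + m + α_m)`, which is positive since `k₁ ≥ n`
  -- and `α_m ≥ 1`.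
  rw [← mul_add, ← Int.cast_add, mul_eq_zero] at hrel
  refine hrel.resolve_right ?_
  rw [Int.cast_eq_zero, ← mul_add]
  exact mul_ne_zero (by omega) (by omega)

end Uniqueness

/-! The Fischer inner product. -/

section Fischer

open MvPolynomial

variable {σ : Type*} [Fintype σ]

/-- The Fischer inner product of two polynomials. -/
def fischer (p q : MvPolynomial σ ℂ) : ℂ :=
  ∑ d ∈ p.support, (∏ i, (d i).factorial : ℕ) * starRingEnd ℂ (coeff d p) * coeff d q

lemma fischer_eq_sum {p : MvPolynomial σ ℂ} {s : Finset (σ →₀ ℕ)} (hs : p.support ⊆ s)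
    (q : MvPolynomial σ ℂ) : fischer p q =
      ∑ d ∈ s, (∏ i, (d i).factorial : ℕ) * starRingEnd ℂ (coeff d p) * coeff d q := by
  refine Finset.sum_subset hs fun d _ hd => ?_
  rw [notMem_support_iff.1 hd, map_zero, mul_zero, zero_mul]

lemma fischer_add_left (p p' q : MvPolynomial σ ℂ) :
    fischer (p + p') q = fischer p q + fischer p' q := by
  classical
  rw [fischer_eq_sum (s := p.support ∪ p'.support) support_add,
    fischer_eq_sum (p := p) Finset.subset_union_left,
    fischer_eq_sum (p := p') Finset.subset_union_right, ← Finset.sum_add_distrib]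
  refine Finset.sum_congr rfl fun d _ => ?_
  rw [coeff_add, map_add]
  ring

lemma fischer_smul_left (c : ℂ) (p q : MvPolynomial σ ℂ) :
    fischer (c • p) q = starRingEnd ℂ c * fischer p q := by
  rw [fischer_eq_sum (s := p.support) support_smul, fischer, Finset.mul_sum]
  refine Finset.sum_congr rfl fun d _ => ?_
  rw [coeff_smul, smul_eq_mul, map_mul]
  ring

/-- The Fischer product as a linear form in its second argument. -/
def fischerForm (p : MvPolynomial σ ℂ) : MvPolynomial σ ℂ →ₗ[ℂ] ℂ where
  toFun := fischer p
  map_add' q q' := by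
    simp only [fischer, coeff_add, mul_add, Finset.sum_add_distrib]
  map_smul' c q := by
    simp only [fischer, coeff_smul, smul_eq_mul, RingHom.id_apply, Finset.mul_sum]
    exact Finset.sum_congr rfl fun _ _ => by ring

lemma fischer_conj_symm (p q : MvPolynomial σ ℂ) :
    starRingEnd ℂ (fischer q p) = fischer p q := by
  classical
  rw [fischer_eq_sum (s := p.support ∪ q.support) Finset.subset_union_right,
    fischer_eq_sum (p := p) (s := p.support ∪ q.support) Finset.subset_union_left, map_sum]
  refine Finset.sum_congr rfl fun d _ => ?_
  rw [map_mul, map_mul, Complex.conj_conj, Complex.conj_natCast]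
  ring

lemma fischer_self (p : MvPolynomial σ ℂ) : fischer p p =
    ((∑ d ∈ p.support, (∏ i, (d i).factorial : ℕ) * ‖coeff d p‖ ^ 2 : ℝ) : ℂ) := by
  rw [fischer, Complex.ofReal_sum]
  refine Finset.sum_congr rfl fun d _ => ?_
  rw [mul_assoc, Complex.conj_mul']
  push_cast
  rfl

lemma fischer_self_nonneg (p : MvPolynomial σ ℂ) : 0 ≤ (fischer p p).re := by
  rw [fischer_self, Complex.ofReal_re]
  positivity

lemma eq_zero_of_fischer_self {p : MvPolynomial σ ℂ} (h : (fischer p p).re = 0) : p = 0 := by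
  rw [fischer_self, Complex.ofReal_re, Finset.sum_eq_zero_iff_of_nonneg (fun d _ => by
    positivity)] at h
  ext d
  by_cases hd : d ∈ p.support
  · have h₁ := h d hd
    have h₂ : ((∏ i, (d i).factorial : ℕ) : ℝ) ≠ 0 :=
      Nat.cast_ne_zero.2 (Finset.prod_ne_zero_iff.2 fun i _ => Nat.factorial_ne_zero _)
    simpa [h₂] using (mul_eq_zero.1 h₁).resolve_left h₂
  · simpa using hd

/-- The Fischer product as an inner product space structure. -/
abbrev fischerCore : InnerProductSpace.Core ℂ (MvPolynomial σ ℂ) where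
  inner := fischer
  conj_inner_symm := fischer_conj_symm
  re_inner_nonneg := fischer_self_nonneg
  add_left := fischer_add_left
  smul_left p q c := fischer_smul_left c p q
  definite p h := eq_zero_of_fischer_self (by
    change fischer p p = 0 at h
    rw [h, Complex.zero_re])

lemma fischer_monomial (d : σ →₀ ℕ) (a : ℂ) (q : MvPolynomial σ ℂ) :
    fischer (monomial d a) q =
      (∏ i, (d i).factorial : ℕ) * starRingEnd ℂ a * coeff d q := by
  classical
  rw [fischer_eq_sum support_monomial_subset, Finset.sum_singleton, coeff_monomial, if_pos rfl]

lemma prod_factorial_add_single (d : σ →₀ ℕ) (i : σ) :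
    ∏ j, ((d + Finsupp.single i 1 : σ →₀ ℕ) j).factorial = (d i + 1) * ∏ j, (d j).factorial := by
  classical
  rw [← Finset.mul_prod_erase _ _ (Finset.mem_univ i),
    ← Finset.mul_prod_erase _ (fun j => (d j).factorial) (Finset.mem_univ i), ← mul_assoc]
  congr 1
  · simp [Nat.factorial_succ]
  · refine Finset.prod_congr rfl fun j hj => ?_
    rw [Finsupp.add_apply, Finsupp.single_apply, if_neg (Finset.ne_of_mem_erase hj).symm,
      add_zero]

/-- Multiplication by a variable is adjoint to the partial derivative. -/
lemma fischer_pderiv (i : σ) (p q : MvPolynomial σ ℂ) :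
    fischer (pderiv i p) q = fischer p (X i * q) := by
  classical
  induction p using MvPolynomial.induction_on' with
  | monomial d a =>
    rw [pderiv_monomial, fischer_monomial, fischer_monomial, coeff_X_mul']
    by_cases h : d i = 0
    · simp [h]
    · rw [if_pos (by simpa using h)]
      have hle : Finsupp.single i 1 ≤ d := Finsupp.single_le_iff.2 (Nat.one_le_iff_ne_zero.2 h)
      have hd := prod_factorial_add_single (d - Finsupp.single i 1) i
      rw [tsub_add_cancel_of_le hle] at hd
      have hdi : (d - Finsupp.single i 1 : σ →₀ ℕ) i + 1 = d i := by
        simp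
        omega
      rw [hd, hdi, map_mul, Complex.conj_natCast]
      push_cast
      ring
  | add p p' hp hp' => rw [map_add, fischer_add_left, hp, hp', fischer_add_left]

lemma fischer_sum_right {κ : Type*} (s : Finset κ) (p : MvPolynomial σ ℂ)
    (f : κ → MvPolynomial σ ℂ) : fischer p (∑ i ∈ s, f i) = ∑ i ∈ s, fischer p (f i) :=
  map_sum (fischerForm p) f s

lemma fischer_sum_left {κ : Type*} (s : Finset κ) (f : κ → MvPolynomial σ ℂ)
    (q : MvPolynomial σ ℂ) : fischer (∑ i ∈ s, f i) q = ∑ i ∈ s, fischer (f i) q := by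
  classical
  induction s using Finset.induction_on with
  | empty => simp [fischer]
  | insert a s ha ih => rw [Finset.sum_insert ha, fischer_add_left, ih, Finset.sum_insert ha]

end Fischer

/-- Subtract from some `u₀` with `f u₀ ≠ 0` a preimage `w₀ ∈ ker f` of the orthogonal projection of
`J u₀` to `J(ker f)`. The difference is nonzero because `f` separates `u₀` from `w₀`, so `J` need
not be injective. -/
lemma exists_ne_zero_orthogonal_ker {U V : Type*} [AddCommGroup U] [Module ℂ U]
    [FiniteDimensional ℂ U] [AddCommGroup V] [Module ℂ V] (c : InnerProductSpace.Core ℂ V)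
    (J : U →ₗ[ℂ] V) (f : U →ₗ[ℂ] ℂ) (hf : f ≠ 0) :
    ∃ u : U, u ≠ 0 ∧ ∀ w : U, f w = 0 → c.inner (J u) (J w) = 0 := by
  let _ : NormedAddCommGroup V := c.toNormedAddCommGroup
  let _ : InnerProductSpace ℂ V := InnerProductSpace.ofCore c.toCore
  obtain ⟨u₀, hu₀⟩ : ∃ u, f u ≠ 0 := by
    by_contra! h
    exact hf (LinearMap.ext h)
  let K : Submodule ℂ V := (LinearMap.ker f).map J
  obtain ⟨w₀, hw₀, hw₀'⟩ : K.starProjection (J u₀) ∈ K := K.starProjection_apply_mem _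
  refine ⟨u₀ - w₀, fun h => hu₀ ?_, fun w hw => ?_⟩
  · rw [sub_eq_zero.1 h]
    exact hw₀
  · have h := K.sub_starProjection_mem_orthogonal (J u₀)
    rw [← hw₀', ← map_sub, Submodule.mem_orthogonal'] at h
    exact h (J w) ⟨w, hw, rfl⟩

/-! Existence of a nonzero pluriharmonic element. -/

section PullbackInjective

variable {n : ℕ}

/-- The substitution `X_i = (M_i, 0)`, `Y_i = (1, 0)`, where `M_1 = W` and `M_2 = Z`. -/
def pullbackRetraction (n k₁ k₂ : ℕ) : PolyXY n (Fin k₁ ⊕ Fin k₂) →ₐ[ℂ] PolyWZ n :=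
  MvPolynomial.aeval (Sum.elim
    (fun p => Sum.elim (fun u : Fin k₁ => if h : (u : ℕ) < n then matW n p.1 ⟨u, h⟩ else 0)
      (fun u : Fin k₂ => if h : (u : ℕ) < n then matZ n p.1 ⟨u, h⟩ else 0) p.2)
    (fun p => Sum.elim (fun u : Fin k₁ => if (u : ℕ) = p.1 then 1 else 0)
      (fun u : Fin k₂ => if (u : ℕ) = p.1 then 1 else 0) p.2))

lemma pullbackRetraction_pullback {k₁ k₂ : ℕ} (hk₁ : n ≤ k₁) (hk₂ : n ≤ k₂) (Q : PolyWZ n) :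
    pullbackRetraction n k₁ k₂ (pullback n k₁ k₂ Q) = Q := by
  have h : (pullbackRetraction n k₁ k₂).comp (pullback n k₁ k₂) = AlgHom.id ℂ _ := by
    refine MvPolynomial.algHom_ext fun p => ?_
    rw [AlgHom.comp_apply, AlgHom.id_apply]
    rcases p with ⟨i, j⟩ | ⟨i, j⟩
    · have h₁ := pullback_matW k₁ k₂ i j
      rw [matW, Matrix.of_apply] at h₁
      rw [h₁, blockProd, map_sum, Finset.sum_eq_single (Fin.castLE hk₁ j)]
      · simp [pullbackRetraction, matW]
      · intro u _ hu
        have : (u : ℕ) ≠ j := fun h => hu (Fin.ext h)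
        simp [pullbackRetraction, this]
      · simp
    · have h₁ := pullback_matZ k₁ k₂ i j
      rw [matZ, Matrix.of_apply] at h₁
      rw [h₁, blockProd, map_sum, Finset.sum_eq_single (Fin.castLE hk₂ j)]
      · simp [pullbackRetraction, matZ]
      · intro u _ hu
        have : (u : ℕ) ≠ j := fun h => hu (Fin.ext h)
        simp [pullbackRetraction, this]
      · simp
  exact DFunLike.congr_fun h Q

/-- For `k₁, k₂ ≥ n` the pullback has a left inverse, so no information is lost on `ℂ[W, Z]`. -/
lemma isPluriharmonic_pullback_iff {k₁ k₂ : ℕ} (hk₁ : n ≤ k₁) (hk₂ : n ≤ k₂) (Q : PolyWZ n) :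
    IsPluriharmonic (pullback n k₁ k₂ Q) ↔ ∀ s t, radialPart k₁ k₂ s t Q = 0 := by
  refine forall_congr' fun s => forall_congr' fun t => ?_
  rw [laplacian_pullback]
  refine ⟨fun h => ?_, fun h => by rw [h, map_zero]⟩
  rw [← pullbackRetraction_pullback hk₁ hk₂ (radialPart k₁ k₂ s t Q), h, map_zero]

end PullbackInjective

lemma satisfiesRelations_of_mem_spaceH {N v k₁ k₂ : ℕ} (hk₁ : N + 1 ≤ k₁) (hk₂ : N + 1 ≤ k₂)
    {C : Index (N + 1) v → ℂ} (hC : ofCoeffs C ∈ spaceH (N + 1) v k₁ k₂) :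
    SatisfiesRelations k₁ k₂ C := by
  intro α _ m hm hα
  have h := (isPluriharmonic_pullback_iff hk₁ hk₂ _).1 hC.2 0 m
  rw [ofCoeffs_eq_substQ] at h
  rw [← coeff_coordOp k₁ k₂ C α m hm hα, ← canonSubst_radialPart, h, map_zero,
    MvPolynomial.coeff_zero]

section Existence

variable {n v : ℕ}

/-- The linear factor restores the degree lost by differentiation; `v = 0` is separate because `v -
1` is truncated. -/
lemma isHomogeneous_mul_pderiv {σ : Type*} {f g : MvPolynomial σ ℂ} {v : ℕ}
    (hf : f.IsHomogeneous v) (hg : g.IsHomogeneous 1) (i : σ) :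
    (g * MvPolynomial.pderiv i f).IsHomogeneous v := by
  cases v with
  | zero =>
    have h : f = MvPolynomial.C (MvPolynomial.coeff 0 f) :=
      MvPolynomial.totalDegree_eq_zero_iff_eq_C.1 (Nat.le_zero.1 hf.totalDegree_le)
    rw [h, MvPolynomial.pderiv_C, mul_zero]
    exact MvPolynomial.isHomogeneous_zero _ _ _
  | succ v =>
    have h := hg.mul (hf.pderiv (i := i))
    rwa [Nat.add_sub_cancel, add_comm] at h

lemma isHomogeneous_mul_mul_pderiv_pderiv {σ : Type*} {f g g' : MvPolynomial σ ℂ} {v : ℕ}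
    (hf : f.IsHomogeneous v) (hg : g.IsHomogeneous 1) (hg' : g'.IsHomogeneous 1) (i j : σ) :
    (g * (g' * MvPolynomial.pderiv i (MvPolynomial.pderiv j f))).IsHomogeneous v := by
  cases v with
  | zero =>
    have h : f = MvPolynomial.C (MvPolynomial.coeff 0 f) :=
      MvPolynomial.totalDegree_eq_zero_iff_eq_C.1 (Nat.le_zero.1 hf.totalDegree_le)
    rw [h, MvPolynomial.pderiv_C, map_zero, mul_zero, mul_zero]
    exact MvPolynomial.isHomogeneous_zero _ _ _
  | succ v =>
    have h := hg.mul (isHomogeneous_mul_pderiv (hf.pderiv (i := j)) hg' i)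
    rwa [Nat.add_sub_cancel, add_comm] at h

lemma isHomogeneous_varExt (e : ℕ) : (varExt n e).IsHomogeneous 1 := by
  unfold varExt
  split_ifs
  · exact MvPolynomial.isHomogeneous_X _ _
  · exact MvPolynomial.isHomogeneous_zero _ _ _

lemma isHomogeneous_coordOp_mul (k₁ k₂ c : ℕ) {q L : MvPolynomial (Fin (n + 1)) ℂ}
    (hq : q.IsHomogeneous v) (hL : L.IsHomogeneous 1) :
    (coordOp k₁ k₂ c q * L).IsHomogeneous v := by
  have hconst : ∀ (P : Prop) [Decidable P] (κ : MvPolynomial (Fin (n + 1)) ℂ) (κ' : ℂ)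
      (a : Fin (n + 1)), κ = MvPolynomial.C κ' →
      ((if P then κ else 0) * MvPolynomial.pderiv a q * L).IsHomogeneous v := by
    intro P _ κ κ' a hκ
    split_ifs
    · rw [hκ, mul_assoc, mul_comm (MvPolynomial.pderiv a q)]
      exact (isHomogeneous_mul_pderiv hq hL a).C_mul κ'
    · rw [zero_mul, zero_mul]
      exact MvPolynomial.isHomogeneous_zero _ _ _
  have hite : ∀ (P : Prop) [Decidable P] (e : ℕ),
      (if P then varExt n e else 0).IsHomogeneous 1 := by
    intro P _ e
    split_ifs
    · exact isHomogeneous_varExt e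
    · exact MvPolynomial.isHomogeneous_zero _ _ _
  rw [coordOp, add_mul, add_mul, Finset.sum_mul, Finset.sum_mul, Finset.sum_mul]
  refine ((MvPolynomial.IsHomogeneous.sum _ _ _ fun a _ => ?_).add
    (MvPolynomial.IsHomogeneous.sum _ _ _ fun a _ => ?_)).add
    (MvPolynomial.IsHomogeneous.sum _ _ _ fun a _ => ?_)
  · exact hconst _ _ ((k₁ : ℂ) + 1 - n + c) a (by simp)
  · exact hconst _ _ ((k₂ : ℂ) - c) a (by simp)
  · rw [Finset.sum_mul]
    refine MvPolynomial.IsHomogeneous.sum _ _ _ fun b _ => ?_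
    have h : ((pencilSign b a c : ℤ) : MvPolynomial (Fin (n + 1)) ℂ) =
      MvPolynomial.C ((pencilSign b a c : ℤ) : ℂ) := by simp
    rw [h, mul_assoc, mul_assoc, mul_comm (MvPolynomial.pderiv b _) L]
    exact (isHomogeneous_mul_mul_pderiv_pderiv hq
      ((hite _ _).sub (hite _ _)) hL b a).C_mul _

/-- The contraction of the matrix of radial parts with `W + Z`. -/
lemma exists_ofCoeffs_eq_sum_radialPart (k₁ k₂ : ℕ) (C : Index n v → ℂ) :
    ∃ D : Index n v → ℂ, ofCoeffs D =
      ∑ s, ∑ t, (matW n s t + matZ n s t) * radialPart k₁ k₂ s t (ofCoeffs C) := by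
  -- `L c` is `tr((W + Z) A_c)` in the coordinates `Q_a`. It has degree one and compensates the
  -- degree lost by `coordOp`, so the contraction stays in degree `v`.
  let L : ℕ → MvPolynomial (Fin (n + 1)) ℂ := fun c =>
    MvPolynomial.C ((n : ℂ) - c) * varExt n c + MvPolynomial.C ((c : ℂ) + 1) * varExt n (c + 1)
  have hL : ∀ c, (L c).IsHomogeneous 1 := fun c =>
    ((isHomogeneous_varExt c).C_mul _).add ((isHomogeneous_varExt (c + 1)).C_mul _)
  have hhom : (∑ c ∈ Finset.range (2 * n + 1),
      coordOp k₁ k₂ c (toPoly n v C) * L c).IsHomogeneous v :=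
    MvPolynomial.IsHomogeneous.sum _ _ _ fun c _ =>
      isHomogeneous_coordOp_mul k₁ k₂ c (isHomogeneous_toPoly C) (hL c)
  obtain ⟨D, hD⟩ := exists_toPoly_eq hhom
  refine ⟨D, ?_⟩
  have hsubst : ∀ c, substQ n (L c) =
      ∑ s, ∑ t, (matW n s t + matZ n s t) * genAdj n c t s := by
    intro c
    rw [sum_W_add_Z_mul_genAdj]
    simp only [L, map_add, map_mul, substQ_varExt, ← MvPolynomial.algebraMap_eq, map_sub,
      map_natCast, map_one]
  rw [ofCoeffs_eq_substQ, ofCoeffs_eq_substQ, hD, map_sum]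
  simp only [map_mul, hsubst, radialPart_substQ, Finset.mul_sum]
  rw [← sum_sum_sum_comm]
  refine Finset.sum_congr rfl fun s _ => Finset.sum_congr rfl fun t _ =>
    Finset.sum_congr rfl fun c _ => by ring

/-- The adjoint of `Δ_{s,t}` is multiplication by `(X ᵗY)_{s,t}`, which is the pullback of `(W +
Z)_{s,t}`. -/
lemma fischer_pullback_laplacian (k₁ k₂ : ℕ) (Q : PolyWZ n) :
    ∑ s, ∑ t, fischer (laplacian s t (pullback n k₁ k₂ Q)) (laplacian s t (pullback n k₁ k₂ Q)) =
      fischer (pullback n k₁ k₂ Q) (pullback n k₁ k₂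
        (∑ s, ∑ t, (matW n s t + matZ n s t) * radialPart k₁ k₂ s t Q)) := by
  have h : ∀ (s t : Fin n) (P R : PolyXY n (Fin k₁ ⊕ Fin k₂)), fischer (laplacian s t P) R =
      fischer P ((blockProd Sum.inl (s, t) + blockProd Sum.inr (s, t)) * R) := by
    intro s t P R
    have hb : (blockProd Sum.inl (s, t) + blockProd Sum.inr (s, t) :
        PolyXY n (Fin k₁ ⊕ Fin k₂)) = ∑ u : Fin k₁ ⊕ Fin k₂,
          MvPolynomial.X (Sum.inr (t, u)) * MvPolynomial.X (Sum.inl (s, u)) := by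
      rw [Fintype.sum_sum_type]
      simp only [blockProd, mul_comm (MvPolynomial.X (Sum.inr _))]
    rw [laplacian, fischer_sum_left, hb, Finset.sum_mul, fischer_sum_right]
    refine Finset.sum_congr rfl fun u _ => ?_
    rw [fischer_pderiv, fischer_pderiv, mul_assoc]
  simp only [h, map_sum, map_mul, map_add, pullback_matW, pullback_matZ, fischer_sum_right]
  simp only [laplacian_pullback]

/-- The value at `W = 1`, `Z = -1`. -/
def antidiagonalValue (n v : ℕ) : (Index n v → ℂ) →ₗ[ℂ] ℂ :=
  (substWZ (1 : Matrix (Fin n) (Fin n) ℂ) (-1)).toLinearMap ∘ₗ (substQ n).toLinearMap ∘ₗ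
    toPoly n v

lemma antidiagonalValue_apply (C : Index n v → ℂ) :
    antidiagonalValue n v C = substWZ (1 : Matrix (Fin n) (Fin n) ℂ) (-1) (ofCoeffs C) := by
  rw [ofCoeffs_eq_substQ]
  rfl

lemma antidiagonalValue_ne_zero : antidiagonalValue n v ≠ 0 := by
  -- The test element `Q_0^v = det(W)^v` takes the value `1` at `W = 1`.
  obtain ⟨C, hC⟩ := exists_toPoly_eq
    (MvPolynomial.isHomogeneous_X_pow (R := ℂ) (0 : Fin (n + 1)) v)
  intro h
  have h₁ := LinearMap.congr_fun h C
  rw [antidiagonalValue_apply, ofCoeffs_eq_substQ, hC, substWZ_substQ, map_pow,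
    MvPolynomial.aeval_X, Fin.val_zero, detCoeff_zero, Matrix.det_one, one_pow] at h₁
  exact one_ne_zero h₁

/-- Take `Q` orthogonal to all invariants vanishing at `(1, -1)`. The contraction of its radial
parts with `W + Z` is such an invariant, so the sum of the squared norms of the `Δ_{s,t}` vanishes.
-/
lemma exists_mem_spaceH (n v k₁ k₂ : ℕ) :
    ∃ C : Index n v → ℂ, C ≠ 0 ∧ ofCoeffs C ∈ spaceH n v k₁ k₂ := by
  obtain ⟨C, hC, horth⟩ := exists_ne_zero_orthogonal_ker fischerCore
    ((pullback n k₁ k₂).toLinearMap ∘ₗ (substQ n).toLinearMap ∘ₗ toPoly n v)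
    (antidiagonalValue n v) antidiagonalValue_ne_zero
  refine ⟨C, hC, ofCoeffs_mem_spaceQ C, ?_⟩
  obtain ⟨D, hD⟩ := exists_ofCoeffs_eq_sum_radialPart k₁ k₂ C
  have hDval : antidiagonalValue n v D = 0 := by
    rw [antidiagonalValue_apply, hD]
    simp only [map_sum, map_mul, map_add]
    refine Finset.sum_eq_zero fun s _ => Finset.sum_eq_zero fun t _ => ?_
    have h : substWZ (1 : Matrix (Fin n) (Fin n) ℂ) (-1) (matW n s t) +
        substWZ (1 : Matrix (Fin n) (Fin n) ℂ) (-1) (matZ n s t) = 0 := by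
      simp [substWZ, matW, matZ]
    rw [h, zero_mul]
  have h := horth D hDval
  have hJ : ∀ E : Index n v → ℂ, ((pullback n k₁ k₂).toLinearMap ∘ₗ
      (substQ n).toLinearMap ∘ₗ toPoly n v) E = pullback n k₁ k₂ (ofCoeffs E) := by
    intro E
    rw [ofCoeffs_eq_substQ]
    rfl
  rw [hJ, hJ, hD] at h
  have hsum := (fischer_pullback_laplacian k₁ k₂ (ofCoeffs C)).trans h
  have hre := congrArg Complex.re hsum
  rw [Complex.zero_re, Complex.re_sum] at hre
  simp only [Complex.re_sum] at hre
  intro s t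
  have h₁ := (Finset.sum_eq_zero_iff_of_nonneg fun s _ =>
    Finset.sum_nonneg fun t _ => fischer_self_nonneg _).1 hre s (Finset.mem_univ s)
  have h₂ := (Finset.sum_eq_zero_iff_of_nonneg fun t _ => fischer_self_nonneg _).1 h₁ t
    (Finset.mem_univ t)
  exact eq_zero_of_fischer_self h₂

end Existence

/-! ### One-dimensionality and sufficiency of the relations -/

section OneDimensional

variable {N v k₁ k₂ : ℕ}

lemma ofCoeffs_smul {n : ℕ} (c : ℂ) (C : Index n v → ℂ) : ofCoeffs (c • C) = c • ofCoeffs C := by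
  rw [ofCoeffs_eq_substQ, ofCoeffs_eq_substQ, map_smul, map_smul]

lemma SatisfiesRelations.sub_smul {n : ℕ} {C D : Index n v → ℂ} (hC : SatisfiesRelations k₁ k₂ C)
    (hD : SatisfiesRelations k₁ k₂ D) (c : ℂ) : SatisfiesRelations k₁ k₂ (C - c • D) := by
  have hext : ∀ β, coeffExt (C - c • D) β = coeffExt C β - c * coeffExt D β := by
    intro β
    rw [coeffExt, coeffExt, coeffExt, Finset.mul_sum, ← Finset.sum_sub_distrib]
    refine Finset.sum_congr rfl fun α _ => ?_
    split_ifs <;> simp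
  intro α hα m hm hmin
  have h₁ := hC α hα m hm hmin
  have h₂ := hD α hα m hm hmin
  have h₃ : ∀ (P : Prop) [Decidable P] (A B x : ℂ), (if P then (A - c * B) * x else 0) =
      (if P then A * x else 0) - c * (if P then B * x else 0) := by
    intro P _ A B x
    split_ifs <;> ring
  have h₄ : relationExpr k₁ k₂ (C - c • D) (fun j => (α.1 j : ℤ)) m =
      relationExpr k₁ k₂ C (fun j => (α.1 j : ℤ)) m -
        c * relationExpr k₁ k₂ D (fun j => (α.1 j : ℤ)) m := by
    simp only [relationExpr, hext, h₃, Finset.sum_sub_distrib, ← Finset.mul_sum]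
    ring
  rw [h₄, h₁, h₂, mul_zero, sub_zero]

/-- By uniqueness a nonzero element has a nonzero last coefficient, so it can be normalised. -/
lemma exists_mem_spaceH_last_eq_one (hk₁ : N + 1 ≤ k₁) (hk₂ : N + 1 ≤ k₂) :
    ∃ C : Index (N + 1) v → ℂ, C (lastIndex (N + 1) v) = 1 ∧
      ofCoeffs C ∈ spaceH (N + 1) v k₁ k₂ := by
  obtain ⟨C, hC, hCH⟩ := exists_mem_spaceH (N + 1) v k₁ k₂
  have hlast : C (lastIndex (N + 1) v) ≠ 0 := fun h =>
    hC (eq_zero_of_satisfiesRelations hk₁ (satisfiesRelations_of_mem_spaceH hk₁ hk₂ hCH) h)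
  refine ⟨(C (lastIndex (N + 1) v))⁻¹ • C, inv_mul_cancel₀ hlast, ?_⟩
  rw [ofCoeffs_smul]
  exact Submodule.smul_mem _ _ hCH

lemma eq_smul_of_satisfiesRelations (hk₁ : N + 1 ≤ k₁) {C D : Index (N + 1) v → ℂ}
    (hC : SatisfiesRelations k₁ k₂ C) (hD : SatisfiesRelations k₁ k₂ D)
    (hD₁ : D (lastIndex (N + 1) v) = 1) : C = C (lastIndex (N + 1) v) • D := by
  rw [← sub_eq_zero]
  refine eq_zero_of_satisfiesRelations hk₁ (hC.sub_smul hD _) ?_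
  simp [hD₁]

/-- Sufficiency needs no computation: a solution is a multiple of the normalised element of
`spaceH`, which also satisfies the relations. -/
lemma ofCoeffs_mem_spaceH_iff (hk₁ : N + 1 ≤ k₁) (hk₂ : N + 1 ≤ k₂)
    (C : Index (N + 1) v → ℂ) :
    ofCoeffs C ∈ spaceH (N + 1) v k₁ k₂ ↔ SatisfiesRelations k₁ k₂ C := by
  refine ⟨satisfiesRelations_of_mem_spaceH hk₁ hk₂, fun hC => ?_⟩
  obtain ⟨D, hD₁, hD⟩ := exists_mem_spaceH_last_eq_one (v := v) hk₁ hk₂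
  rw [eq_smul_of_satisfiesRelations hk₁ hC (satisfiesRelations_of_mem_spaceH hk₁ hk₂ hD) hD₁,
    ofCoeffs_smul]
  exact Submodule.smul_mem _ _ hD

lemma existsUnique_satisfiesRelations (hk₁ : N + 1 ≤ k₁) (hk₂ : N + 1 ≤ k₂) (c : ℂ) :
    ∃! C : Index (N + 1) v → ℂ,
      SatisfiesRelations k₁ k₂ C ∧ C (lastIndex (N + 1) v) = c := by
  obtain ⟨D, hD₁, hD⟩ := exists_mem_spaceH_last_eq_one (v := v) hk₁ hk₂
  have hDr := satisfiesRelations_of_mem_spaceH hk₁ hk₂ hD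
  refine ⟨c • D, ⟨?_, ?_⟩, fun C hC => ?_⟩
  · rw [← ofCoeffs_mem_spaceH_iff hk₁ hk₂, ofCoeffs_smul]
    exact Submodule.smul_mem _ _ hD
  · simp [hD₁]
  · rw [eq_smul_of_satisfiesRelations hk₁ hC.1 hDr hD₁, hC.2]

lemma finrank_spaceH (hk₁ : N + 1 ≤ k₁) (hk₂ : N + 1 ≤ k₂) :
    Module.finrank ℂ (spaceH (N + 1) v k₁ k₂) = 1 := by
  obtain ⟨D, hD₁, hD⟩ := exists_mem_spaceH_last_eq_one (v := v) hk₁ hk₂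
  have hDr := satisfiesRelations_of_mem_spaceH hk₁ hk₂ hD
  refine finrank_eq_one ⟨ofCoeffs D, hD⟩ ?_ ?_
  · intro h
    have h₁ : ofCoeffs D = ofCoeffs (0 : Index (N + 1) v → ℂ) := by
      refine (Subtype.ext_iff.1 h).trans ?_
      simp [ofCoeffs]
    rw [ofCoeffs_injective h₁] at hD₁
    exact zero_ne_one hD₁
  · rintro ⟨Q, hQ⟩
    obtain ⟨C, rfl, -⟩ := existsUnique_ofCoeffs hQ.1
    refine ⟨C (lastIndex (N + 1) v), Subtype.ext ?_⟩
    change C (lastIndex (N + 1) v) • ofCoeffs D = ofCoeffs C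
    rw [← ofCoeffs_smul, ← eq_smul_of_satisfiesRelations hk₁
      (satisfiesRelations_of_mem_spaceH hk₁ hk₂ hQ) hDr hD₁]

end OneDimensional

/-! The operators `D_Q` on exponential functions. -/

section Exponential

variable {n : ℕ}

/-- The linear form `Z ↦ tr (A Z)`. -/
def traceForm (A : Matrix (Fin n) (Fin n) ℂ) : Matrix (Fin n) (Fin n) ℂ →ₗ[ℂ] ℂ :=
  Matrix.traceLinearMap (Fin n) ℂ ℂ ∘ₗ LinearMap.mulLeft ℂ A

/-- The transposition in the definition of `∂/∂Z` makes the eigenvalue on `exp(tr(AZ))` the entry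
`A_{s,t}`, not its transpose. -/
lemma traceForm_single (A : Matrix (Fin n) (Fin n) ℂ) (p : Fin n × Fin n) :
    traceForm A (Matrix.single p.2 p.1 1) = A p.1 p.2 := by
  simp [traceForm, Matrix.trace_mul_single]

/-- The function `Z ↦ exp (tr (A Z))`. -/
def expTrace (A : Matrix (Fin n) (Fin n) ℂ) (Z : Matrix (Fin n) (Fin n) ℂ) : ℂ :=
  Complex.exp (traceForm A Z)

lemma differentiable_expTrace (A : Matrix (Fin n) (Fin n) ℂ) :
    Differentiable ℂ (expTrace A) :=
  (LinearMap.toContinuousLinearMap (traceForm A)).differentiable.cexp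

lemma entryDeriv_expTrace (p : Fin n × Fin n) (c : ℂ) (A : Matrix (Fin n) (Fin n) ℂ) :
    entryDeriv p (c • expTrace A) = (A p.1 p.2 * c) • expTrace A := by
  funext Z
  rw [entryDeriv, lineDeriv]
  have h : (fun τ : ℂ => (c • expTrace A) (Z + τ • Matrix.single p.2 p.1 1)) =
      fun τ : ℂ => c * Complex.exp (traceForm A Z + τ * A p.1 p.2) := by
    funext τ
    rw [Pi.smul_apply, expTrace, map_add, map_smul, traceForm_single, smul_eq_mul, smul_eq_mul]
  have h' : HasDerivAt (fun τ : ℂ => c * Complex.exp (traceForm A Z + τ * A p.1 p.2))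
      (c * (Complex.exp (traceForm A Z + 0 * A p.1 p.2) * (1 * A p.1 p.2))) 0 :=
    ((((hasDerivAt_id (0 : ℂ)).mul_const _).const_add _).cexp).const_mul c
  rw [h, h'.deriv, Pi.smul_apply, expTrace, zero_mul, add_zero, smul_eq_mul]
  ring

lemma monomialDeriv_expTrace (d : Fin n × Fin n →₀ ℕ) (A : Matrix (Fin n) (Fin n) ℂ) :
    monomialDeriv d (expTrace A) = (∏ p : Fin n × Fin n, A p.1 p.2 ^ d p) • expTrace A := by
  have h : ∀ l : List (Fin n × Fin n), l.foldr entryDeriv (expTrace A) =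
      (l.map fun p => A p.1 p.2).prod • expTrace A := by
    intro l
    induction l with
    | nil => simp
    | cons p l ih => rw [List.foldr_cons, ih, entryDeriv_expTrace, List.map_cons, List.prod_cons]
  rw [monomialDeriv, h, Multiset.prod_map_toList, Finsupp.toMultiset_map, Finsupp.prod_toMultiset,
    Finsupp.prod_mapDomain_index (by simp) (by simp [pow_add]), Finsupp.prod_fintype _ _ (by simp)]

/-- The function `Z ↦ exp (tr (A Z))` as a holomorphic function on the upper half-space. -/
def expTraceHol (A : Matrix (Fin n) (Fin n) ℂ) : Hol n :=
  ⟨expTrace A, (differentiable_expTrace A).differentiableOn⟩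

/-- Exponentials are joint eigenfunctions of the partial derivatives, so `D_Q` acts on a pair of
them by its symbol `Q(A, B)`. -/
lemma bilinearOp_expTrace (Q : PolyWZ n) (A B : Matrix (Fin n) (Fin n) ℂ) (Z : upperHalf n) :
    bilinearOp n Q (expTraceHol A) (expTraceHol B) Z =
      substWZ A B Q * (expTrace A Z.1 * expTrace B Z.1) := by
  induction Q using MvPolynomial.induction_on' with
  | monomial d c =>
    have h : (MvPolynomial.monomial d c : PolyWZ n) =
        c • MvPolynomial.basisMonomials ((Fin n × Fin n) ⊕ (Fin n × Fin n)) ℂ d := by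
      rw [MvPolynomial.coe_basisMonomials, MvPolynomial.smul_monomial, smul_eq_mul, mul_one]
    have h' : substWZ A B (MvPolynomial.monomial d c) =
        c * ((∏ p : Fin n × Fin n, A p.1 p.2 ^ d (Sum.inl p)) *
          ∏ p : Fin n × Fin n, B p.1 p.2 ^ d (Sum.inr p)) := by
      rw [substWZ, MvPolynomial.aeval_monomial, Finsupp.prod_fintype _ _ (by simp),
        Fintype.prod_sum_type]
      rfl
    rw [h', h, map_smul, bilinearOp, Module.Basis.constr_basis]
    change c * (monomialDeriv _ (expTrace A) Z.1 * monomialDeriv _ (expTrace B) Z.1) = _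
    rw [monomialDeriv_expTrace, monomialDeriv_expTrace]
    simp only [Finsupp.fst_sumFinsuppEquivProdFinsupp, Finsupp.snd_sumFinsuppEquivProdFinsupp,
      Pi.smul_apply, smul_eq_mul]
    ring
  | add P Q hP hQ =>
    rw [map_add, map_add, add_mul, ← hP, ← hQ]
    rfl

lemma upperHalf_nonempty (n : ℕ) : (upperHalf n).Nonempty := by
  refine ⟨Complex.I • 1, ?_⟩
  have h : (1 / (2 * Complex.I)) • ((Complex.I • (1 : Matrix (Fin n) (Fin n) ℂ)) -
      (Complex.I • (1 : Matrix (Fin n) (Fin n) ℂ))ᴴ) = 1 := by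
    rw [Matrix.conjTranspose_smul, Matrix.conjTranspose_one, ← sub_smul, smul_smul]
    have : 1 / (2 * Complex.I) * (Complex.I - star Complex.I) = 1 := by
      rw [Complex.star_def, Complex.conj_I]
      field_simp
      norm_num
    rw [this, one_smul]
  rw [upperHalf, Set.mem_ofPred_eq, h]
  exact Matrix.PosDef.one

/-- Exponentials never vanish, so the operator at a single point of the half-space determines `Q(A,
B)` for all complex `A`, `B`. -/
lemma bilinearOp_injective (n : ℕ) : Function.Injective (bilinearOp n) := by
  rw [← LinearMap.ker_eq_bot, LinearMap.ker_eq_bot']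
  intro Q hQ
  obtain ⟨Z, hZ⟩ := upperHalf_nonempty n
  refine MvPolynomial.funext fun x => ?_
  let A : Matrix (Fin n) (Fin n) ℂ := Matrix.of fun s t => x (Sum.inl (s, t))
  let B : Matrix (Fin n) (Fin n) ℂ := Matrix.of fun s t => x (Sum.inr (s, t))
  have h := bilinearOp_expTrace Q A B ⟨Z, hZ⟩
  rw [hQ] at h
  have h' : substWZ A B Q = 0 := (mul_eq_zero.1 h.symm).resolve_right
    (mul_ne_zero (Complex.exp_ne_zero _) (Complex.exp_ne_zero _))
  rw [map_zero, ← h']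
  exact eval_eq_substWZ x Q

end Exponential

end RankinCohen

end

theorem theorem4p5 (n v k₁ k₂ : ℕ) (hn : 1 ≤ n) (hk₁ : n ≤ k₁) (hk₂ : n ≤ k₂) :
    (∀ Q ∈ RankinCohen.spaceQ n v,
      ∃! C : RankinCohen.Index n v → ℂ, Q = RankinCohen.ofCoeffs C) ∧
    (∀ C : RankinCohen.Index n v → ℂ,
      RankinCohen.ofCoeffs C ∈ RankinCohen.spaceH n v k₁ k₂ ↔
        RankinCohen.SatisfiesRelations k₁ k₂ C) ∧
    (∀ c : ℂ, ∃! C : RankinCohen.Index n v → ℂ,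
      RankinCohen.SatisfiesRelations k₁ k₂ C ∧ C (RankinCohen.lastIndex n v) = c) ∧
    Module.finrank ℂ (RankinCohen.spaceH n v k₁ k₂) = 1 ∧
    Module.finrank ℂ
      ((RankinCohen.spaceH n v k₁ k₂).map (RankinCohen.bilinearOp n)) = 1 := by
  -- The canonical pencil requires a first row, which is where `n ≥ 1` enters.
  obtain ⟨N, rfl⟩ : ∃ N, n = N + 1 := ⟨n - 1, by omega⟩
  refine ⟨fun Q hQ => RankinCohen.existsUnique_ofCoeffs hQ,
    fun C => RankinCohen.ofCoeffs_mem_spaceH_iff hk₁ hk₂ C,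
    fun c => RankinCohen.existsUnique_satisfiesRelations hk₁ hk₂ c,
    RankinCohen.finrank_spaceH hk₁ hk₂, ?_⟩
  exact (LinearEquiv.finrank_eq (Submodule.equivMapOfInjective _
    (RankinCohen.bilinearOp_injective _) _)).symm.trans
      (RankinCohen.finrank_spaceH (v := v) hk₁ hk₂)
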